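/- Let $\mathcal D(n,p)$ denote the random digraph on vertex set $[n]=\{1,\dots,n\}$ in which each of the $n(n-1)$ arcs $(u,v)$ with $u\neq v$ is present independently with probability $p$. A directed Hamilton cycle of a digraph is a directed cycle passing through every vertex exactly once; two such cycles are distinct if their arc sets differ. Let $p=p(n)\in[0,1]$ satisfy $p=\omega\!\left(\frac{\log^2 n}{n}\right)$ as $n\to\infty$, and let $X_n$ be the number of directed Hamilton cycles of $D\sim\mathcal D(n,p(n))$. Then with high probability $X_n=(1\pm o(1))^n\,n!\,p^n$; that is, there is a sequence $\varepsilon_n\in[0,1)$ with $\varepsilon_n\to 0$ such that $$\lim_{n\to\infty}\Pr\Big[(1-\varepsilon_n)^n\,n!\,p(n)^n\;\le\; X_n\;\le\;(1+\varepsilon_n)^n\,n!\,p(n)^n\Big]=1 .$$ -/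

import Mathlib

open Filter Topology MeasureTheory ProbabilityTheory Asymptotics
open scoped unitInterval

namespace Digraph

/-- The digraph on `V` whose arcs are the ordered pairs in `A`. -/
def ofArcSet {V : Type*} (A : Set (V × V)) : Digraph V where
  Adj u v := (u, v) ∈ A

/-- A digraph `H` on `V` is a directed Hamilton cycle (on the vertex set `V`) if there are at least
two vertices and they can be listed, each exactly once, as `v 0, …, v (k - 1)` so that the arcs of
`H` are exactly `v 0 → v 1 → ⋯ → v (k - 1) → v 0`. Here `finRotate k` is `i ↦ i + 1` modulo `k`. -/
def IsHamiltonCycle {V : Type*} (H : Digraph V) : Prop :=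
  ∃ (k : ℕ) (v : Fin k ≃ V), 2 ≤ k ∧
    ∀ x y : V, H.Adj x y ↔ ∃ i : Fin k, x = v i ∧ y = v (finRotate k i)

/-- The number of directed Hamilton cycles contained in `D`; a cycle is identified with the
subdigraph formed by its arcs, so that rotations of a vertex list are not counted separately. -/
noncomputable def hamiltonCycleCount {V : Type*} (D : Digraph V) : ℕ :=
  {H : Digraph V | H.IsHamiltonCycle ∧ H ≤ D}.ncard

instance instMeasurableSpace {V : Type*} : MeasurableSpace (Digraph V) := ⊤

/-- The random digraph `𝒟(n, p)` on `n` labelled vertices: each of the `n (n - 1)` arcs `(u, v)`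
with `u ≠ v` is present with probability `p`, independently; there are no loops. -/
noncomputable def binomialRandom (n : ℕ) (p : I) : Measure (Digraph (Fin n)) :=
  (setBernoulli {e : Fin n × Fin n | e.1 ≠ e.2} p).map ofArcSet

instance instIsProbabilityMeasure (n : ℕ) (p : I) : IsProbabilityMeasure (binomialRandom n p) :=
  Measure.isProbabilityMeasure_map (measurable_of_countable _).aemeasurable

end Digraph

/-!
The upper bound is Markov's inequality for the expected number `(n - 1)! p ^ n` of cycles.

For the lower bound, the second moment method only shows that about `n! p ^ n` cycles are present
with probability at least `exp (-O(1 / p)) / n`. By concentration of measure, in the product space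
whose coordinates are the rows of the adjacency matrix, even such an unlikely event is with high
probability within Hamming distance `r` of the random digraph, for a small multiple `r` of
`n / log n`: the density condition says that `r ^ 2 / n` is much larger than `1 / p`. So changing
the out-neighbourhoods of `r` vertices gives a digraph with about `n! p ^ n` cycles.

Cutting such a cycle at these vertices leaves `r` paths of the random digraph. Contracting the paths
turns a further sprinkling of arcs into a random digraph on `r` vertices, and a Hamilton cycle of it
closes the paths up to a Hamilton cycle again. It exists with high probability, since a random
digraph is at least as likely to be Hamiltonian as a random graph (McDiarmid's coupling), and Pósa's
rotations deal with the latter. At most `r! = exp (o(n))` cycles are turned into the same one.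
-/

open Finset
open scoped Nat

section BernoulliPi

variable {ι κ : Type*} [Fintype ι] [Fintype κ]

/-- The law of a random predicate on `ι` that holds at each point with probability `p`,
independently. It is the source of randomness for all graphs and digraphs below. -/
noncomputable def bernoulliPi (ι : Type*) [Fintype ι] (p : I) : Measure (ι → Prop) :=
  Measure.pi fun _ ↦ Ber(True, False, p)

instance (p : I) : IsProbabilityMeasure (bernoulliPi ι p) :=
  inferInstanceAs (IsProbabilityMeasure (Measure.pi _))

theorem measurePreserving_comp_bernoulliPi {g : κ → ι} (hg : g.Injective) (p : I) :
    MeasurePreserving (fun ω : ι → Prop ↦ ω ∘ g) (bernoulliPi ι p) (bernoulliPi κ p) := by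
  refine ⟨Measurable.of_discrete, ?_⟩
  have hindep : iIndepFun (fun i (ω : ι → Prop) ↦ ω i) (bernoulliPi ι p) :=
    iIndepFun_pi fun _ ↦ aemeasurable_id
  have hmap := (iIndepFun_iff_map_fun_eq_pi_map
    fun k ↦ (measurable_pi_apply (g k)).aemeasurable).1 (hindep.precomp hg)
  have hcoord (i : ι) : (bernoulliPi ι p).map (fun ω ↦ ω i) = Ber(True, False, p) :=
    (measurePreserving_eval _ i).map_eq
  simp only [hcoord] at hmap
  exact hmap

theorem measurePreserving_curry_bernoulliPi (p : I) :
    MeasurePreserving Function.curry (bernoulliPi (ι × κ) p)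
      (Measure.pi fun _ : ι ↦ bernoulliPi κ p) := by
  refine ⟨.of_discrete, ?_⟩
  have hcurry := Measure.infinitePi_map_curry (fun (_ : ι) (_ : κ) ↦ Ber(True, False, p))
  simp only [Measure.infinitePi_eq_pi] at hcurry
  exact hcurry

theorem pi_real_forall_mem {α : Type*} [MeasurableSpace α] [DiscreteMeasurableSpace α]
    (μ : Measure α) [IsProbabilityMeasure μ] (B : Finset ι) (t : Set α) :
    (Measure.pi fun _ : ι ↦ μ).real {ω | ∀ i ∈ B, ω i ∈ t} = μ.real t ^ #B := by
  classical
  have hpi : {ω : ι → α | ∀ i ∈ B, ω i ∈ t} =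
      Set.univ.pi fun i ↦ if i ∈ B then t else Set.univ := by
    ext ω
    simp [Set.mem_pi]
  rw [hpi, measureReal_def, Measure.pi_pi, ENNReal.toReal_prod]
  simp [apply_ite, prod_ite_mem, Measure.real]

theorem bernoulliPi_real_forall_mem (B : Finset ι) (p : I) :
    (bernoulliPi ι p).real {ω | ∀ i ∈ B, ω i} = (p : ℝ) ^ #B := by
  simpa [bernoulliPi] using pi_real_forall_mem Ber(True, False, p) B {a | a}

theorem bernoulliPi_real_forall_mem_not (B : Finset ι) (p : I) :
    (bernoulliPi ι p).real {ω | ∀ i ∈ B, ¬ ω i} = (1 - p : ℝ) ^ #B := by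
  simpa [bernoulliPi] using pi_real_forall_mem Ber(True, False, p) B {a | ¬ a}

theorem measurePreserving_sup_bernoulliMeasure {p p₁ p₂ : I} (hp : σ p = σ p₁ * σ p₂) :
    MeasurePreserving (fun a : Prop × Prop ↦ a.1 ⊔ a.2)
      (Ber(True, False, p₁).prod Ber(True, False, p₂)) Ber(True, False, p) := by
  refine ⟨.of_discrete, ?_⟩
  have := Measure.isProbabilityMeasure_map
    (μ := Ber(True, False, p₁).prod Ber(True, False, p₂))
    (Measurable.of_discrete (f := fun a : Prop × Prop ↦ a.1 ⊔ a.2)).aemeasurable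
  have hfalse : ((Ber(True, False, p₁).prod Ber(True, False, p₂)).map
      fun a ↦ a.1 ⊔ a.2).real {False} = Ber(True, False, p).real {False} := by
    have hpre : (fun a : Prop × Prop ↦ a.1 ⊔ a.2) ⁻¹' {False} = {False} ×ˢ {False} := by
      ext a
      simp [Prod.ext_iff]
    rw [map_measureReal_apply .of_discrete .of_discrete, hpre, measureReal_prod_prod]
    simpa using (congrArg Subtype.val hp).symm
  refine ext_iff_measureReal_singleton.2 fun a ↦ ?_
  by_cases ha : a
  · have hcompl : ({a} : Set Prop) = {False}ᶜ := by
      ext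
      simp [ha]
    rw [hcompl, probReal_compl_eq_one_sub .of_discrete, hfalse,
      probReal_compl_eq_one_sub .of_discrete]
  · simpa [ha] using hfalse

theorem measurePreserving_sup_bernoulliPi {p p₁ p₂ : I} (hp : σ p = σ p₁ * σ p₂) :
    MeasurePreserving (fun ω : (ι → Prop) × (ι → Prop) ↦ ω.1 ⊔ ω.2)
      ((bernoulliPi ι p₁).prod (bernoulliPi ι p₂)) (bernoulliPi ι p) :=
  (measurePreserving_pi _ _ fun _ ↦ measurePreserving_sup_bernoulliMeasure hp).comp
    (measurePreserving_arrowProdEquivProdArrow Prop Prop ι _ _).symm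

theorem exists_symm_eq_symm_mul_symm {p q : I} (hpq : p ≤ q) : ∃ r : I, σ q = σ p * σ r := by
  have hle : (σ q : ℝ) ≤ σ p := unitInterval.symm_le_symm.2 hpq
  refine ⟨σ ⟨_, unitInterval.div_mem (σ q).2.1 (σ p).2.1 hle⟩, Subtype.ext ?_⟩
  rw [unitInterval.symm_symm, Set.Icc.coe_mul,
    mul_div_cancel_of_imp' fun h ↦ le_antisymm (h ▸ hle) (σ q).2.1]

theorem bernoulliPi_real_mono {p q : I} (hpq : p ≤ q) {s : Set (ι → Prop)} (hs : IsUpperSet s) :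
    (bernoulliPi ι p).real s ≤ (bernoulliPi ι q).real s := by
  obtain ⟨r, hr⟩ := exists_symm_eq_symm_mul_symm hpq
  have hsup := measurePreserving_sup_bernoulliPi (ι := ι) hr
  calc (bernoulliPi ι p).real s
      = ((bernoulliPi ι p).prod (bernoulliPi ι r)).real (Prod.fst ⁻¹' s) :=
        (measurePreserving_fst.measureReal_preimage
          MeasurableSet.of_discrete.nullMeasurableSet).symm
    _ ≤ ((bernoulliPi ι p).prod (bernoulliPi ι r)).real ((fun ω ↦ ω.1 ⊔ ω.2) ⁻¹' s) :=
        measureReal_mono fun _ hω ↦ hs le_sup_left hω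
    _ = (bernoulliPi ι q).real s :=
        hsup.measureReal_preimage MeasurableSet.of_discrete.nullMeasurableSet

theorem setBernoulli_eq_map_bernoulliPi (u : Set ι) (p : I) :
    setBernoulli u p = (bernoulliPi ι p).map fun ω ↦ {i | i ∈ u ∧ ω i} := by
  have hcoord (i : ι) : Ber(True, False, p).map (fun a ↦ i ∈ u ∧ a) =
      unitInterval.toNNReal p • Measure.dirac (i ∈ u) +
        unitInterval.toNNReal (σ p) • Measure.dirac False := by
    rw [map_bernoulliMeasure, and_true, and_false, bernoulliMeasure_def]
  rw [setBernoulli_eq_map, Measure.infinitePi_eq_pi]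
  simp only [← hcoord]
  rw [← Measure.pi_map_pi fun i ↦ Measurable.of_discrete.aemeasurable,
    Measure.map_map Measurable.of_discrete Measurable.of_discrete]
  rfl

end BernoulliPi

theorem prod_real_le_add {α β : Type*} [MeasurableSpace α] [MeasurableSpace β] {μ : Measure α}
    {ν : Measure β} [IsProbabilityMeasure μ] [IsProbabilityMeasure ν] {S : Set (α × β)}
    (hS : MeasurableSet S) {s : Set α} (hs : MeasurableSet s) {δ : ℝ} (hδ : 0 ≤ δ)
    (h : ∀ x ∉ s, ν.real (Prod.mk x ⁻¹' S) ≤ δ) : (μ.prod ν).real S ≤ μ.real s + δ := by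
  have hsection (x : α) : ν (Prod.mk x ⁻¹' S) ≤ s.indicator 1 x + ENNReal.ofReal δ := by
    by_cases hx : x ∈ s
    · simpa [hx] using prob_le_one.trans le_self_add
    · simpa [hx] using (ENNReal.le_ofReal_iff_toReal_le (measure_ne_top _ _) hδ).2 (h x hx)
  have hle : (μ.prod ν) S ≤ μ s + ENNReal.ofReal δ := by
    calc (μ.prod ν) S = ∫⁻ x, ν (Prod.mk x ⁻¹' S) ∂μ := Measure.prod_apply hS
      _ ≤ ∫⁻ x, (s.indicator 1 x + ENNReal.ofReal δ) ∂μ := lintegral_mono hsection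
      _ = μ s + ENNReal.ofReal δ := by
        rw [lintegral_add_right _ measurable_const, lintegral_indicator_one hs]
        simp
  calc (μ.prod ν).real S ≤ (μ s + ENNReal.ofReal δ).toReal :=
        ENNReal.toReal_mono (by finiteness) hle
    _ = μ.real s + δ := by
        rw [ENNReal.toReal_add (by finiteness) (by finiteness), ENNReal.toReal_ofReal hδ,
          Measure.real]

section Concentration

theorem hasSubgaussianMGF_comp_measurePreserving {Ω Ω' : Type*} [MeasurableSpace Ω]
    [MeasurableSpace Ω'] {μ : Measure Ω} {ν : Measure Ω'} {f : Ω → Ω'}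
    (hf : MeasurePreserving f μ ν) {X : Ω' → ℝ} {c : NNReal} (hX : HasSubgaussianMGF X c ν) :
    HasSubgaussianMGF (fun ω ↦ X (f ω)) c μ :=
  .of_map hf.aemeasurable (hf.map_eq ▸ hX)

variable {α β : Type*} [Finite α] [MeasurableSpace α] [DiscreteMeasurableSpace α]
  [Finite β] [MeasurableSpace β] [DiscreteMeasurableSpace β]

theorem hasSubgaussianMGF_sub_integral_prod {μ : Measure α} {ν : Measure β}
    [IsProbabilityMeasure μ] [IsProbabilityMeasure ν] {F : α × β → ℝ}
    (hF : ∀ x x' y, F (x, y) - F (x', y) ≤ 1) {c : NNReal}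
    (hc : HasSubgaussianMGF (fun y ↦ ∫ x, F (x, y) ∂μ - ∫ y, ∫ x, F (x, y) ∂μ ∂ν) c ν) :
    HasSubgaussianMGF (fun z ↦ F z - ∫ z, F z ∂μ.prod ν) (c + 1 / 4) (μ.prod ν) := by
  set g : β → ℝ := fun y ↦ ∫ x, F (x, y) ∂μ
  have hsection (y : β) (t : ℝ) :
      ∫ x, Real.exp (t * (F (x, y) - g y)) ∂μ ≤ Real.exp (t ^ 2 / 8) := by
    have := μ.nonempty_of_neZero
    obtain ⟨x₁, hx₁⟩ := Finite.exists_min fun x ↦ F (x, y)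
    refine ((hasSubgaussianMGF_of_mem_Icc (a := F (x₁, y)) (b := F (x₁, y) + 1)
      Measurable.of_discrete.aemeasurable (.of_forall fun x ↦ ⟨hx₁ x, ?_⟩)).mgf_le t).trans_eq ?_
    · linarith [hF x x₁ y]
    · congr 1
      norm_num
      ring
  refine ⟨fun t ↦ .of_finite, fun t ↦ ?_⟩
  have hint : ∫ z, F z ∂μ.prod ν = ∫ y, g y ∂ν := integral_prod_symm _ .of_finite
  calc ∫ z, Real.exp (t * (F z - ∫ z, F z ∂μ.prod ν)) ∂μ.prod ν
      = ∫ y, Real.exp (t * (g y - ∫ y, g y ∂ν)) * ∫ x, Real.exp (t * (F (x, y) - g y)) ∂μ ∂ν := by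
        rw [integral_prod_symm _ .of_finite, hint]
        simp only [← integral_const_mul, ← Real.exp_add]
        exact integral_congr_ae <| .of_forall fun y ↦ integral_congr_ae <| .of_forall fun x ↦
          congrArg Real.exp (by ring)
    _ ≤ ∫ y, Real.exp (t * (g y - ∫ y, g y ∂ν)) * Real.exp (t ^ 2 / 8) ∂ν :=
        integral_mono .of_finite .of_finite fun y ↦
          mul_le_mul_of_nonneg_left (hsection y t) (Real.exp_nonneg _)
    _ ≤ Real.exp (c * t ^ 2 / 2) * Real.exp (t ^ 2 / 8) := by
        rw [integral_mul_const]
        exact mul_le_mul_of_nonneg_right (hc.mgf_le t) (Real.exp_nonneg _)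
    _ = Real.exp (↑(c + 1 / 4) * t ^ 2 / 2) := by
        rw [← Real.exp_add]
        push_cast
        ring_nf

/-- A form of McDiarmid's bounded differences inequality. -/
theorem hasSubgaussianMGF_sub_integral_pi {n : ℕ} (μ : Fin n → Measure α)
    [∀ i, IsProbabilityMeasure (μ i)] {F : (Fin n → α) → ℝ}
    (hF : ∀ ω i x, F (Function.update ω i x) - F ω ≤ 1) :
    HasSubgaussianMGF (fun ω ↦ F ω - ∫ ω, F ω ∂Measure.pi μ) (n / 4) (Measure.pi μ) := by
  induction n with
  | zero =>
    have hzero : (fun ω ↦ F ω - ∫ ω, F ω ∂Measure.pi μ) = fun _ ↦ 0 := by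
      funext ω
      simp [Subsingleton.elim _ ω]
    simp [hzero]
  | succ n ih =>
    have hmp := measurePreserving_piFinSuccAbove μ 0
    simp only [Fin.succAbove_zero] at hmp
    set G : α × (Fin n → α) → ℝ := fun z ↦ F (Fin.cons z.1 z.2)
    have hG (x x' : α) (y : Fin n → α) : G (x, y) - G (x', y) ≤ 1 := by
      simpa using hF (Fin.cons x' y) 0 x
    have hmean (ω : Fin n → α) (i : Fin n) (a : α) :
        ∫ x, G (x, Function.update ω i a) ∂μ 0 - ∫ x, G (x, ω) ∂μ 0 ≤ 1 := by
      rw [← integral_sub .of_finite .of_finite]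
      refine (integral_mono .of_finite (integrable_const 1) fun x ↦ ?_).trans_eq (by simp)
      simpa [G, Fin.cons_update] using hF (Fin.cons x ω) i.succ a
    have key := hasSubgaussianMGF_sub_integral_prod hG (ih (fun i ↦ μ i.succ) hmean)
    have hF' : F = fun ω ↦ G (MeasurableEquiv.piFinSuccAbove (fun _ ↦ α) 0 ω) := by
      funext ω
      exact congrArg F (Fin.cons_self_tail ω).symm
    have hcard : ((n + 1 : ℕ) / 4 : NNReal) = n / 4 + 1 / 4 := by
      push_cast
      ring
    rw [hcard, hF', hmp.integral_comp']
    exact hasSubgaussianMGF_comp_measurePreserving hmp key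

theorem hammingDist_update_le_one {κ γ : Type*} [Fintype κ] [DecidableEq κ] [DecidableEq γ]
    (ω : κ → γ) (i : κ) (x : γ) : hammingDist (Function.update ω i x) ω ≤ 1 := by
  refine (card_le_card (t := {i}) fun j hj ↦ ?_).trans (card_singleton i).le
  by_contra hji
  simp_all

theorem infDist_toHamming_update_sub_le_one {κ γ : Type*} [Fintype κ] [DecidableEq κ]
    [DecidableEq γ] (S : Set (Hamming fun _ : κ ↦ γ)) (ω : κ → γ) (i : κ) (x : γ) :
    Metric.infDist (Hamming.toHamming (Function.update ω i x)) S -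
      Metric.infDist (Hamming.toHamming ω) S ≤ 1 := by
  have hdist := Metric.infDist_le_infDist_add_dist (s := S)
    (x := Hamming.toHamming (Function.update ω i x)) (y := Hamming.toHamming ω)
  rw [Hamming.dist_eq_hammingDist] at hdist
  have hupdate : (hammingDist (Function.update ω i x) ω : ℝ) ≤ 1 :=
    mod_cast hammingDist_update_le_one ω i x
  exact sub_le_iff_le_add'.2 (hdist.trans (add_le_add_right hupdate _))

theorem real_mul_real_le_hammingDist_le [DecidableEq α] {n : ℕ} (μ : Fin n → Measure α)
    [∀ i, IsProbabilityMeasure (μ i)] (S : Set (Fin n → α)) (r : ℕ) :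
    (Measure.pi μ).real S * (Measure.pi μ).real {ω | ∀ ω' ∈ S, r ≤ hammingDist ω ω'} ≤
      Real.exp (-(r : ℝ) ^ 2 / n) := by
  obtain rfl | hS := S.eq_empty_or_nonempty
  · simpa using Real.exp_nonneg _
  set F : (Fin n → α) → ℝ :=
    fun ω ↦ Metric.infDist (Hamming.toHamming ω) (Hamming.toHamming '' S)
  have hF_mem {ω : Fin n → α} (hω : ω ∈ S) : F ω = 0 :=
    Metric.infDist_zero_of_mem (Set.mem_image_of_mem _ hω)
  have hF_far {ω : Fin n → α} (hω : ∀ ω' ∈ S, r ≤ hammingDist ω ω') : (r : ℝ) ≤ F ω := by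
    refine (Metric.le_infDist (hS.image _)).2 (Set.forall_mem_image.2 fun ω' hω' ↦ ?_)
    rw [Hamming.dist_eq_hammingDist]
    exact mod_cast hω ω' hω'
  set X : (Fin n → α) → ℝ := fun ω ↦ F ω - ∫ ω, F ω ∂Measure.pi μ
  have hX : HasSubgaussianMGF X (n / 4) (Measure.pi μ) := hasSubgaussianMGF_sub_integral_pi μ
    (infDist_toHamming_update_sub_le_one _)
  have hdiff := (hasSubgaussianMGF_comp_measurePreserving
    (measurePreserving_snd (μ := Measure.pi μ)) hX).sub_of_indepFun
    (hasSubgaussianMGF_comp_measurePreserving (measurePreserving_fst (ν := Measure.pi μ)) hX)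
    (indepFun_prod (X := X) (Y := X) .of_discrete .of_discrete).symm
  rw [← measureReal_prod_prod]
  refine (measureReal_mono fun z hz ↦ ?_).trans <|
    (hdiff.measure_ge_le (Nat.cast_nonneg r)).trans_eq ?_
  · simpa [X, hF_mem hz.1] using hF_far hz.2
  · congr 2
    push_cast
    ring

end Concentration

section SecondMoment

theorem natCast_card_filter_mem {Ω ι : Type*} (s : Finset ι) (A : ι → Set Ω)
    [∀ ω, DecidablePred fun i ↦ ω ∈ A i] (ω : Ω) :
    (#{i ∈ s | ω ∈ A i} : ℝ) = ∑ i ∈ s, (A i).indicator (fun _ ↦ 1) ω := by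
  simp [Set.indicator_apply]

variable {Ω : Type*} [MeasurableSpace Ω] {μ : Measure Ω} [IsProbabilityMeasure μ]

theorem inv_le_real_half_integral_le {f : Ω → ℝ} (hfm : Measurable f) (hf : MemLp f 2 μ)
    (hpos : 0 < ∫ ω, f ω ∂μ) {M : ℝ} (hM : 0 < M)
    (hsq : ∫ ω, f ω ^ 2 ∂μ ≤ M * (∫ ω, f ω ∂μ) ^ 2) :
    (4 * M)⁻¹ ≤ μ.real {ω | (∫ ω, f ω ∂μ) / 2 ≤ f ω} := by
  set m := ∫ ω, f ω ∂μ
  set A : Set Ω := {ω | m / 2 ≤ f ω}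
  have hA : MeasurableSet A := measurableSet_le measurable_const hfm
  have hpointwise (ω : Ω) :
      f ω ≤ m / 2 + (4 * M * m)⁻¹ * f ω ^ 2 + A.indicator (fun _ ↦ M * m) ω := by
    by_cases hω : ω ∈ A
    · have hamgm : (4 * M * m)⁻¹ * f ω ^ 2 + M * m - f ω =
          (4 * M * m)⁻¹ * (f ω - 2 * M * m) ^ 2 := by
        field_simp
        ring
      have : 0 ≤ (4 * M * m)⁻¹ * (f ω - 2 * M * m) ^ 2 := by positivity
      rw [Set.indicator_of_mem hω]
      linarith
    · have : 0 ≤ (4 * M * m)⁻¹ * f ω ^ 2 := by positivity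
      rw [Set.indicator_of_notMem hω]
      linarith [not_le.1 (show ¬m / 2 ≤ f ω from hω)]
  have hsqint : Integrable (fun ω ↦ (4 * M * m)⁻¹ * f ω ^ 2) μ := hf.integrable_sq.const_mul _
  have hsum : Integrable (fun ω ↦ m / 2 + (4 * M * m)⁻¹ * f ω ^ 2) μ :=
    (integrable_const _).add hsqint
  have hind : Integrable (A.indicator fun _ ↦ M * m) μ := (integrable_const _).indicator hA
  have hint : m ≤ m / 2 + (4 * M * m)⁻¹ * ∫ ω, f ω ^ 2 ∂μ + M * m * μ.real A := by
    calc m ≤ ∫ ω, (m / 2 + (4 * M * m)⁻¹ * f ω ^ 2 + A.indicator (fun _ ↦ M * m) ω) ∂μ :=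
          integral_mono (hf.integrable one_le_two) (hsum.add hind) hpointwise
      _ = m / 2 + (4 * M * m)⁻¹ * ∫ ω, f ω ^ 2 ∂μ + M * m * μ.real A := by
        rw [integral_add hsum hind, integral_add (integrable_const _) hsqint, integral_const_mul,
          integral_indicator_const _ hA, integral_const, probReal_univ, one_smul, smul_eq_mul,
          mul_comm (μ.real A)]
  have hquarter : (4 * M * m)⁻¹ * ∫ ω, f ω ^ 2 ∂μ ≤ m / 4 := by
    calc (4 * M * m)⁻¹ * ∫ ω, f ω ^ 2 ∂μ ≤ (4 * M * m)⁻¹ * (M * m ^ 2) := by gcongr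
      _ = m / 4 := by field_simp
  rw [inv_le_iff_one_le_mul₀ (by positivity)]
  nlinarith

variable {ι : Type*} (s : Finset ι) {A : ι → Set Ω} [∀ ω, DecidablePred fun i ↦ ω ∈ A i]

theorem integrable_card_filter_mem (hA : ∀ i, MeasurableSet (A i)) :
    Integrable (fun ω ↦ (#{i ∈ s | ω ∈ A i} : ℝ)) μ := by
  simp only [natCast_card_filter_mem]
  exact integrable_finsetSum _ fun i _ ↦ (integrable_const 1).indicator (hA i)

theorem integral_card_filter_mem (hA : ∀ i, MeasurableSet (A i)) :
    ∫ ω, (#{i ∈ s | ω ∈ A i} : ℝ) ∂μ = ∑ i ∈ s, μ.real (A i) := by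
  simp only [natCast_card_filter_mem]
  rw [integral_finsetSum _ fun i _ ↦ (integrable_const 1).indicator (hA i)]
  simp [integral_indicator_const, hA]

theorem real_lt_two_mul_card_filter_mem_le (hA : ∀ i, MeasurableSet (A i)) {δ : ℝ} (hδ : 0 ≤ δ)
    (h : ∀ i ∈ s, μ.real (A i) ≤ δ) :
    μ.real {ω | #s < 2 * #{i ∈ s | ω ∈ A i}} ≤ 2 * δ := by
  obtain rfl | hs := s.eq_empty_or_nonempty
  · simpa using hδ
  have hs : (0 : ℝ) < #s := mod_cast hs.card_pos
  have hmarkov := mul_meas_ge_le_integral_of_nonneg (μ := μ)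
    (f := fun ω ↦ (#{i ∈ s | ω ∈ A i} : ℝ)) (ae_of_all _ fun _ ↦ Nat.cast_nonneg _)
    (integrable_card_filter_mem s hA) (#s / 2)
  have hsum : ∑ i ∈ s, μ.real (A i) ≤ #s * δ := by simpa using sum_le_card_nsmul s _ δ h
  rw [integral_card_filter_mem s hA] at hmarkov
  have hsubset : μ.real {ω | #s < 2 * #{i ∈ s | ω ∈ A i}} ≤
      μ.real {ω | (#s / 2 : ℝ) ≤ #{i ∈ s | ω ∈ A i}} := measureReal_mono fun ω hω ↦ by
    have : (#s : ℝ) < 2 * #{i ∈ s | ω ∈ A i} := mod_cast hω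
    exact (by linarith : (#s / 2 : ℝ) ≤ #{i ∈ s | ω ∈ A i})
  refine hsubset.trans (le_of_mul_le_mul_left ?_ (half_pos hs))
  linarith

end SecondMoment

section CyclicPermutations

open Equiv

variable {V : Type*}

theorem isCycleOn_univ_iff {π : Perm V} :
    π.IsCycleOn Set.univ ↔ ∀ x y, π.SameCycle x y := by
  simp [Perm.IsCycleOn, Set.bijOn_univ, π.bijective]

variable [Fintype V]

theorem isCycleOn_univ_of_cycleType_eq [DecidableEq V] {π : Perm V}
    (h : π.cycleType = {Fintype.card V}) : π.IsCycleOn Set.univ := by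
  have hcycle : π.IsCycle := by simp [← Perm.card_cycleType_eq_one, h]
  have hsupport : π.support = univ := by simp [← card_eq_iff_eq_univ, ← Perm.sum_cycleType, h]
  have hne (x : V) : π x ≠ x := Perm.mem_support.1 (hsupport ▸ mem_univ x)
  exact isCycleOn_univ_iff.2 fun x y ↦ hcycle.sameCycle (hne x) (hne y)

variable (V) in
open scoped Classical in
/-- The cyclic permutations of `V`, which encode the directed Hamilton cycles on `V` through
their arcs `x → π x`. -/
noncomputable def cyclicPerms : Finset (Perm V) :=
  {π | π.IsCycleOn Set.univ}

open scoped Classical in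
/-- The directed Hamilton cycles of the digraph with arc predicate `ω`, as cyclic permutations. -/
noncomputable def cyclesIn (ω : V × V → Prop) : Finset (Perm V) :=
  {π ∈ cyclicPerms V | ∀ x, ω (x, π x)}

theorem mem_cyclicPerms {π : Perm V} : π ∈ cyclicPerms V ↔ π.IsCycleOn Set.univ := by
  simp [cyclicPerms]

theorem mem_cyclesIn {ω : V × V → Prop} {π : Perm V} :
    π ∈ cyclesIn ω ↔ π.IsCycleOn Set.univ ∧ ∀ x, ω (x, π x) := by
  simp [cyclesIn, mem_cyclicPerms]

theorem cyclesIn_mono : Monotone (cyclesIn (V := V)) := fun _ _ h _ hπ ↦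
  mem_cyclesIn.2 ⟨(mem_cyclesIn.1 hπ).1, fun x ↦ h _ ((mem_cyclesIn.1 hπ).2 x)⟩

theorem card_cyclicPerms_le : #(cyclicPerms V) ≤ (Fintype.card V)! := by
  classical
  exact (card_le_univ _).trans_eq Fintype.card_perm

theorem factorial_card_le_card_mul_card_cyclicPerms (hV : 2 ≤ Fintype.card V) :
    (Fintype.card V)! ≤ Fintype.card V * #(cyclicPerms V) := by
  classical
  have hcard := Perm.card_of_cycleType_singleton (α := V) hV le_rfl
  rw [Nat.choose_self, mul_one] at hcard
  rw [← Nat.mul_factorial_pred (by lia : Fintype.card V ≠ 0), ← hcard]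
  refine Nat.mul_le_mul_left _ (card_le_card fun π hπ ↦ ?_)
  exact mem_cyclicPerms.2 (isCycleOn_univ_of_cycleType_eq (mem_filter.1 hπ).2)

variable [DecidableEq V]

theorem card_filter_forall_mem_perm_eq_le (π : Perm V) (F : Finset V) :
    #{τ : Perm V | ∀ x ∈ F, τ x = π x} ≤ (Fintype.card V - #F)! := by
  have hfix : Fintype.card {τ : Perm V // ∀ x, ¬ x ∉ F → τ x = x} = (Fintype.card V - #F)! := by
    rw [← Fintype.card_congr (Perm.subtypeEquivSubtypePerm (· ∉ F)), Fintype.card_perm,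
      Fintype.card_subtype_compl, Fintype.card_coe]
  rw [← hfix, Fintype.card_subtype]
  refine card_le_card_of_injOn (π⁻¹ * ·) (fun τ hτ ↦ ?_) (mul_right_injective _).injOn
  simp_all

/-- The arcs `x → π x` of a permutation `π`. -/
def arcs (π : Perm V) : Finset (V × V) := univ.image fun x ↦ (x, π x)

theorem forall_mem_arcs {π : Perm V} {P : V × V → Prop} :
    (∀ e ∈ arcs π, P e) ↔ ∀ x, P (x, π x) := by
  simp [arcs]

theorem card_arcs (π : Perm V) : #(arcs π) = Fintype.card V :=
  card_image_of_injective _ fun _ _ h ↦ congrArg Prod.fst h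

theorem card_arcs_inter (π τ : Perm V) : #(arcs π ∩ arcs τ) = #{x | τ x = π x} := by
  have hinter : arcs π ∩ arcs τ = ({x | τ x = π x} : Finset V).image fun x ↦ (x, π x) := by
    ext ⟨x, y⟩
    simp only [arcs, mem_inter, mem_image, mem_univ, true_and, mem_filter, Prod.mk.injEq]
    grind
  rw [hinter, card_image_of_injective _ fun _ _ h ↦ congrArg Prod.fst h]

theorem card_arcs_union_add_card (π τ : Perm V) :
    #(arcs π ∪ arcs τ) + #{x | τ x = π x} = 2 * Fintype.card V := by
  rw [← card_arcs_inter, card_union_add_card_inter, card_arcs, card_arcs, two_mul]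

theorem pow_card_eq_sum_sub_one_pow {ι : Type*} [Fintype ι] [DecidableEq ι] (a : ℝ)
    (A : Finset ι) : a ^ #A = ∑ F : Finset ι, if F ⊆ A then (a - 1) ^ #F else 0 := by
  have hbinomial := sum_pow_mul_eq_add_pow (a - 1) 1 A
  rw [sub_add_cancel] at hbinomial
  simp only [one_pow, mul_one] at hbinomial
  rw [← hbinomial, ← sum_filter]
  congr 1
  ext
  simp

/-- The number of agreements of a fixed permutation with a random one is nearly Poisson, with
exponential moments to match. -/
theorem sum_pow_card_apply_eq_le {a : ℝ} (ha : 1 ≤ a) (π : Perm V) :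
    ∑ τ : Perm V, a ^ #{x | τ x = π x} ≤ (Fintype.card V)! * Real.exp a := by
  set n := Fintype.card V with hn
  have ha' : 0 ≤ a - 1 := sub_nonneg.2 ha
  calc ∑ τ : Perm V, a ^ #{x | τ x = π x}
      = ∑ F : Finset V, (a - 1) ^ #F * #{τ : Perm V | ∀ x ∈ F, τ x = π x} := by
        simp only [pow_card_eq_sum_sub_one_pow a]
        rw [sum_comm]
        refine sum_congr rfl fun F _ ↦ ?_
        simp [← sum_filter, subset_iff, mul_comm]
    _ ≤ ∑ F ∈ (univ : Finset V).powerset, (a - 1) ^ #F * ((n - #F)! : ℝ) := by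
        rw [powerset_univ]
        gcongr with F
        exact card_filter_forall_mem_perm_eq_le π F
    _ = ∑ j ∈ range (n + 1), (n ! : ℝ) * ((a - 1) ^ j / j !) := by
        rw [sum_powerset_apply_card fun j ↦ (a - 1) ^ j * ((n - j)! : ℝ), card_univ]
        refine sum_congr rfl fun j hj ↦ ?_
        rw [nsmul_eq_mul, ← hn, ← Nat.choose_mul_factorial_mul_factorial (mem_range_succ_iff.1 hj)]
        push_cast
        field_simp
    _ ≤ n ! * Real.exp a := by
        rw [← mul_sum]
        gcongr
        exact (Real.sum_le_exp_of_nonneg ha' _).trans (Real.exp_le_exp.2 (by linarith))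

end CyclicPermutations

section CountingCycles

open Equiv

variable {V : Type*} [Fintype V]

theorem integral_card_cyclesIn (q : I) :
    ∫ ω, (#(cyclesIn ω) : ℝ) ∂bernoulliPi (V × V) q =
      #(cyclicPerms V) * (q : ℝ) ^ Fintype.card V := by
  classical
  calc ∫ ω, (#(cyclesIn ω) : ℝ) ∂bernoulliPi (V × V) q
      = ∑ π ∈ cyclicPerms V, (bernoulliPi (V × V) q).real {ω | ∀ x, ω (x, π x)} := by
        rw [← integral_card_filter_mem _ fun _ ↦ .of_discrete]
        rfl
    _ = _ := by
        simp_rw [← forall_mem_arcs (P := _), bernoulliPi_real_forall_mem, card_arcs]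
        simp

theorem integral_card_cyclesIn_sq [DecidableEq V] (q : I) :
    ∫ ω, (#(cyclesIn ω) : ℝ) ^ 2 ∂bernoulliPi (V × V) q =
      ∑ π ∈ cyclicPerms V, ∑ τ ∈ cyclicPerms V, (q : ℝ) ^ #(arcs π ∪ arcs τ) := by
  classical
  have hpair (ω : V × V → Prop) : (#(cyclesIn ω) : ℝ) ^ 2 = #{z ∈ cyclicPerms V ×ˢ cyclicPerms V |
      ω ∈ {ω : V × V → Prop | ∀ e ∈ arcs z.1 ∪ arcs z.2, ω e}} := by
    rw [sq, ← Nat.cast_mul, ← card_product, cyclesIn, ← filter_product]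
    simp only [Set.mem_ofPred_eq, forall_mem_union, forall_mem_arcs]
  simp_rw [hpair]
  rw [integral_card_filter_mem _ fun _ ↦ .of_discrete]
  simp only [bernoulliPi_real_forall_mem]
  rw [sum_product]

theorem integral_card_cyclesIn_sq_le {q : I} (hq : 0 < q) (hV : 2 ≤ Fintype.card V) :
    ∫ ω, (#(cyclesIn ω) : ℝ) ^ 2 ∂bernoulliPi (V × V) q ≤
      Fintype.card V * Real.exp (q : ℝ)⁻¹ *
        (∫ ω, (#(cyclesIn ω) : ℝ) ∂bernoulliPi (V × V) q) ^ 2 := by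
  classical
  set n := Fintype.card V with hn
  have hq₀ : (0 : ℝ) < q := hq
  have hfact : (n ! : ℝ) ≤ n * #(cyclicPerms V) :=
    mod_cast factorial_card_le_card_mul_card_cyclicPerms hV
  have hpow (π τ : Perm V) : (q : ℝ) ^ #(arcs π ∪ arcs τ) =
      (q : ℝ) ^ (2 * n) * (q : ℝ)⁻¹ ^ #{x | τ x = π x} := by
    rw [hn, ← card_arcs_union_add_card π τ, pow_add, mul_assoc, ← mul_pow,
      mul_inv_cancel₀ hq₀.ne', one_pow, mul_one]
  have hrow (π : Perm V) : ∑ τ ∈ cyclicPerms V, (q : ℝ) ^ #(arcs π ∪ arcs τ) ≤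
      (q : ℝ) ^ (2 * n) * (n * #(cyclicPerms V) * Real.exp (q : ℝ)⁻¹) := by
    simp_rw [hpow, ← mul_sum]
    gcongr
    calc ∑ τ ∈ cyclicPerms V, (q : ℝ)⁻¹ ^ #{x | τ x = π x}
        ≤ ∑ τ : Perm V, (q : ℝ)⁻¹ ^ #{x | τ x = π x} :=
          sum_le_sum_of_subset_of_nonneg (subset_univ _) fun _ _ _ ↦ by positivity
      _ ≤ n ! * Real.exp (q : ℝ)⁻¹ :=
          sum_pow_card_apply_eq_le ((one_le_inv₀ hq₀).2 q.2.2) π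
      _ ≤ n * #(cyclicPerms V) * Real.exp (q : ℝ)⁻¹ := by gcongr
  rw [integral_card_cyclesIn_sq, integral_card_cyclesIn]
  refine (sum_le_sum fun π _ ↦ hrow π).trans_eq ?_
  rw [sum_const, nsmul_eq_mul]
  ring

theorem inv_le_bernoulliPi_real_half_le_card_cyclesIn {q : I} (hq : 0 < q)
    (hV : 2 ≤ Fintype.card V) :
    (4 * (Fintype.card V * Real.exp (q : ℝ)⁻¹))⁻¹ ≤ (bernoulliPi (V × V) q).real
      {ω | #(cyclicPerms V) * (q : ℝ) ^ Fintype.card V / 2 ≤ #(cyclesIn ω)} := by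
  have hq₀ : (0 : ℝ) < q := hq
  have hcard : 0 < Fintype.card V * #(cyclicPerms V) :=
    (Nat.factorial_pos _).trans_le (factorial_card_le_card_mul_card_cyclicPerms hV)
  have hpos : (0 : ℝ) < #(cyclicPerms V) := mod_cast Nat.pos_of_mul_pos_left hcard
  rw [← integral_card_cyclesIn]
  refine inv_le_real_half_integral_le .of_discrete .of_discrete ?_ ?_
    (integral_card_cyclesIn_sq_le hq hV)
  · rw [integral_card_cyclesIn]
    positivity
  · positivity

end CountingCycles

section Rotation

variable {V : Type*} {G G' : SimpleGraph V}

/-- `l` lists the vertices of a path of `G`. -/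
def IsPathList (G : SimpleGraph V) (l : List V) : Prop := l.Nodup ∧ l.IsChain G.Adj

theorem IsPathList.mono (hG : G ≤ G') {l : List V} (hl : IsPathList G l) : IsPathList G' l :=
  ⟨hl.1, hl.2.imp hG⟩

theorem isPathList_reverse {l : List V} : IsPathList G l.reverse ↔ IsPathList G l := by
  simp only [IsPathList, List.nodup_reverse, List.isChain_reverse, SimpleGraph.adj_comm]

/-- `u` and `v` are consecutive, in some order, in the list `l`. The definition through `IsChain`
makes concatenation and reversal transparent. -/
def Consec (l : List V) (u v : V) : Prop := ¬ l.IsChain fun a b ↦ s(a, b) ≠ s(u, v)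

theorem consec_append {l₁ l₂ : List V} {u v : V} :
    Consec (l₁ ++ l₂) u v ↔ Consec l₁ u v ∨ Consec l₂ u v ∨
      ∃ x ∈ l₁.getLast?, ∃ y ∈ l₂.head?, s(x, y) = s(u, v) := by
  simp only [Consec, List.isChain_append, not_and_or, not_forall, not_not, exists_prop]

theorem consec_reverse {l : List V} {u v : V} : Consec l.reverse u v ↔ Consec l u v := by
  simp only [Consec, List.isChain_reverse, Sym2.eq_swap]

theorem Consec.formPerm_eq [DecidableEq V] {l : List V} (hl : l.Nodup) {u v : V}
    (h : Consec l u v) : l.formPerm u = v ∨ l.formPerm.symm u = v := by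
  simp only [Consec, List.isChain_iff_getElem, not_forall, not_not] at h
  obtain ⟨i, hi, huv⟩ := h
  have hnext := List.formPerm_apply_lt_getElem l hl i hi
  obtain ⟨rfl, rfl⟩ | ⟨rfl, rfl⟩ := Sym2.eq_iff.1 huv
  · exact .inl hnext
  · exact .inr (Equiv.symm_apply_eq _ |>.2 hnext.symm)

/-- `Rotation G P Q` means that `Q` arises from the path `P` by Pósa rotations, which keep the last
vertex fixed: if the first vertex `x` is adjacent to `y`, the part before `y` is reversed. -/
inductive Rotation (G : SimpleGraph V) (P : List V) : List V → Prop
  | refl : Rotation G P P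
  | step {x y : V} {l₁ l₂ : List V} : Rotation G P ((x :: l₁) ++ (y :: l₂)) → G.Adj x y →
      Rotation G P ((x :: l₁).reverse ++ (y :: l₂))

theorem Rotation.perm {P Q : List V} (h : Rotation G P Q) : Q.Perm P := by
  induction h with
  | refl => exact .refl _
  | step _ _ ih => exact ((List.reverse_perm _).append_right _).trans ih

theorem Rotation.getLast?_eq {P Q : List V} (h : Rotation G P Q) : Q.getLast? = P.getLast? := by
  induction h with
  | refl => rfl
  | step _ _ ih =>
    rw [← ih, List.getLast?_append_of_ne_nil _ (List.cons_ne_nil _ _),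
      List.getLast?_append_of_ne_nil _ (List.cons_ne_nil _ _)]

theorem Rotation.isPathList {P Q : List V} (h : Rotation G P Q) (hP : IsPathList G P) :
    IsPathList G Q := by
  induction h with
  | refl => exact hP
  | @step x y l₁ l₂ hQ hxy ih =>
    refine ⟨(hQ.step hxy).perm.nodup_iff.2 hP.1, ?_⟩
    have hchain := ih.2
    rw [List.isChain_append] at hchain ⊢
    refine ⟨?_, hchain.2.1, ?_⟩
    · simpa only [List.isChain_reverse, SimpleGraph.adj_comm] using hchain.1
    · simpa using hxy

theorem isPathList_append_comm {a b : List V} {x y : V} (hl : IsPathList G (a ++ b))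
    (hx : x ∈ (a ++ b).getLast?) (hy : y ∈ (a ++ b).head?) (hb : b ≠ []) (hxy : G.Adj x y) :
    IsPathList G (b ++ a) := by
  have hchain := List.isChain_append.1 hl.2
  refine ⟨List.perm_append_comm.nodup_iff.1 hl.1, List.isChain_append.2
    ⟨hchain.2.1, hchain.1, fun c hc d hd ↦ ?_⟩⟩
  rw [List.getLast?_append_of_ne_nil _ hb] at hx
  rw [List.head?_append, Option.mem_def.1 hd, Option.some_or] at hy
  rwa [Option.mem_unique hc hx, Option.mem_some_iff.1 hy]

variable [Fintype V]

open scoped Classical in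
/-- The first vertices of the paths obtained from `P` by rotations. -/
noncomputable def endpoints (G : SimpleGraph V) (P : List V) : Finset V :=
  {x | ∃ l, Rotation G P (x :: l)}

theorem mem_endpoints {P : List V} {x : V} : x ∈ endpoints G P ↔ ∃ l, Rotation G P (x :: l) := by
  simp [endpoints]

theorem Rotation.exists_mem_endpoints_consec {P : List V} {x y : V} {l₁ l₂ : List V}
    (h : Rotation G P ((x :: l₁) ++ (y :: l₂))) (hxy : G.Adj x y) :
    ∃ u ∈ endpoints G P, Consec ((x :: l₁) ++ (y :: l₂)) u y := by
  have hrotated := h.step hxy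
  rw [← List.dropLast_append_getLast (List.cons_ne_nil x l₁), List.reverse_append] at hrotated
  exact ⟨_, mem_endpoints.2 ⟨_, hrotated⟩, consec_append.2 <| .inr <| .inr
    ⟨_, List.getLast?_eq_getLast_of_ne_nil (List.cons_ne_nil x l₁), y, rfl, rfl⟩⟩

theorem Rotation.consec {P Q : List V} (h : Rotation G P Q) {y : V} (hy : y ∉ endpoints G P)
    (hP : ∀ u ∈ endpoints G P, ¬ Consec P u y) {u : V} (hu : Consec Q u y) : Consec P u y := by
  induction h generalizing u with
  | refl => exact hu
  | @step x z l₁ l₂ hQ hxz ih =>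
    rw [consec_append, consec_reverse] at hu
    obtain hu | hu | ⟨a, ha, b, hb, hab⟩ := hu
    · exact ih (consec_append.2 (.inl hu))
    · exact ih (consec_append.2 (.inr (.inl hu)))
    · simp only [List.getLast?_reverse, List.head?_cons, Option.mem_some_iff] at ha hb
      subst ha hb
      obtain ⟨-, rfl⟩ | ⟨rfl, -⟩ := Sym2.eq_iff.1 hab
      · obtain ⟨w, hw, hwz⟩ := hQ.exists_mem_endpoints_consec hxz
        exact absurd (ih hwz) (hP w hw)
      · exact absurd (mem_endpoints.2 ⟨_, hQ⟩) hy

/-- The key property of rotations: the edges of `P` at `y` survive all of them unless `y` is next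
to a reachable endpoint. -/
theorem exists_mem_endpoints_consec_of_adj {P : List V} {x y : V} (hx : x ∈ endpoints G P)
    (hxy : G.Adj x y) (hyP : y ∈ P) (hy : y ∉ endpoints G P) :
    ∃ u ∈ endpoints G P, Consec P u y := by
  by_contra! hP
  obtain ⟨l, hl⟩ := mem_endpoints.1 hx
  have hyl : y ∈ l := (List.mem_cons.1 (hl.perm.mem_iff.2 hyP)).resolve_left hxy.ne'
  obtain ⟨l₁, l₂, rfl⟩ := List.append_of_mem hyl
  obtain ⟨u, hu, huy⟩ := hl.exists_mem_endpoints_consec hxy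
  exact hP u hu (hl.consec hy hP huy)

/-- Every nonempty set `S` of at most a quarter of the vertices has more than `2 * #S` neighbours
outside itself, in the form: no set `W ⊇ S` of size at most `3 * #S` contains all its neighbours. -/
def Expands (G : SimpleGraph V) : Prop :=
  ∀ S W : Finset V, S.Nonempty → 4 * #S ≤ Fintype.card V → S ⊆ W → #W ≤ 3 * #S →
    ∃ x ∈ S, ∃ y ∉ W, G.Adj x y

theorem Expands.mono (hG : G ≤ G') (h : Expands G) : Expands G' := fun S W hS hcard hSW hW ↦
  let ⟨x, hx, y, hy, hxy⟩ := h S W hS hcard hSW hW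
  ⟨x, hx, y, hy, hG hxy⟩

theorem Expands.card_lt_four_mul_card_endpoints (hE : Expands G) {P : List V}
    (hP : IsPathList G P) (hne : P ≠ []) (hmax : ∀ l, IsPathList G l → l.length ≠ P.length + 1) :
    Fintype.card V < 4 * #(endpoints G P) := by
  classical
  by_contra! hcard
  set E := endpoints G P
  set W := E ∪ (E.image P.formPerm ∪ E.image P.formPerm.symm)
  have hW : #W ≤ 3 * #E := by
    have := card_union_le E (E.image P.formPerm ∪ E.image P.formPerm.symm)
    have := card_union_le (E.image P.formPerm) (E.image P.formPerm.symm)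
    have := card_image_le (s := E) (f := P.formPerm)
    have := card_image_le (s := E) (f := P.formPerm.symm)
    lia
  have hEne : E.Nonempty := by
    obtain ⟨a, l, rfl⟩ := List.exists_cons_of_ne_nil hne
    exact ⟨a, mem_endpoints.2 ⟨l, .refl⟩⟩
  obtain ⟨x, hx, y, hy, hxy⟩ := hE E W hEne hcard subset_union_left hW
  simp only [W, mem_union, not_or] at hy
  have hyP : y ∈ P := by
    by_contra hyP
    obtain ⟨l, hl⟩ := mem_endpoints.1 hx
    have hpath := hl.isPathList hP
    refine hmax (y :: x :: l) ⟨?_, List.isChain_cons_cons.2 ⟨hxy.symm, hpath.2⟩⟩ ?_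
    · exact List.nodup_cons.2 ⟨fun h ↦ hyP (hl.perm.mem_iff.1 h), hpath.1⟩
    · rw [List.length_cons, hl.perm.length_eq]
  obtain ⟨u, hu, huy⟩ := exists_mem_endpoints_consec_of_adj hx hxy hyP hy.1
  obtain h | h := huy.formPerm_eq hP.1
  · exact hy.2.1 (mem_image.2 ⟨u, hu, h⟩)
  · exact hy.2.2 (mem_image.2 ⟨u, hu, h⟩)

theorem Expands.exists_adj_compl_of_card_le (hE : Expands G) {U : Finset V} (hU : U.Nonempty)
    (hcard : #U ≤ 3 * (Fintype.card V / 4)) : ∃ x ∈ U, ∃ y ∉ U, G.Adj x y := by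
  have := hU.card_pos
  obtain hle | hlt := le_total (4 * #U) (Fintype.card V)
  · exact hE U U hU hle subset_rfl (by lia)
  · obtain ⟨S, hSU, hS⟩ := exists_subset_card_eq (show Fintype.card V / 4 ≤ #U by lia)
    obtain ⟨x, hx, y, hy, hxy⟩ := hE S U (card_pos.1 (by lia)) (by lia) hSU (by lia)
    exact ⟨x, hSU hx, y, hy, hxy⟩

theorem Expands.exists_adj_compl (hE : Expands G) (hV : 4 ≤ Fintype.card V) {U : Finset V}
    (hU : U.Nonempty) (hU' : U ≠ univ) : ∃ x ∈ U, ∃ y ∉ U, G.Adj x y := by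
  classical
  by_cases hcard : #U ≤ 3 * (Fintype.card V / 4)
  · exact hE.exists_adj_compl_of_card_le hU hcard
  · have hcompl := card_compl U
    obtain ⟨x, hx, y, hy, hxy⟩ := hE.exists_adj_compl_of_card_le (U := Uᶜ)
      (nonempty_iff_ne_empty.2 fun h ↦ hU' (compl_eq_empty_iff U |>.1 h)) (by lia)
    exact ⟨y, by simpa using hy, x, by simpa using hx, hxy.symm⟩

/-- `G` has a Hamilton cycle, given as a list of vertices. -/
def HasHamiltonList (G : SimpleGraph V) : Prop :=
  ∃ l : List V, IsPathList G l ∧ l.length = Fintype.card V ∧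
    ∃ x ∈ l.getLast?, ∃ y ∈ l.head?, G.Adj x y

theorem HasHamiltonList.mono (hG : G ≤ G') : HasHamiltonList G → HasHamiltonList G' :=
  fun ⟨l, hl, hlen, x, hx, y, hy, hxy⟩ ↦ ⟨l, hl.mono hG, hlen, x, hx, y, hy, hG hxy⟩

/-- `G` is Hamiltonian or has a path with `k` vertices; this is the progress measure when edges
are added to `G` one round after the other. -/
def HasLongPath (G : SimpleGraph V) (k : ℕ) : Prop :=
  HasHamiltonList G ∨ ∃ l, IsPathList G l ∧ l.length = k

theorem HasLongPath.mono (hG : G ≤ G') {k : ℕ} : HasLongPath G k → HasLongPath G' k :=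
  Or.imp (.mono hG) fun ⟨l, hl, hlen⟩ ↦ ⟨l, hl.mono hG, hlen⟩

theorem HasLongPath.hasHamiltonList {k : ℕ} (hk : Fintype.card V < k) (h : HasLongPath G k) :
    HasHamiltonList G :=
  h.resolve_right fun ⟨_, hl, hlen⟩ ↦ (hl.1.length_le_card.trans_lt hk).ne hlen

theorem Expands.hasLongPath_two (hE : Expands G) (hV : 4 ≤ Fintype.card V) :
    HasLongPath G 2 := by
  obtain ⟨x⟩ : Nonempty V := Fintype.card_pos_iff.1 (by lia)
  have hx : ({x} : Finset V) ≠ univ := fun h ↦ by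
    have := congrArg card h
    rw [card_singleton, card_univ] at this
    lia
  obtain ⟨z, -, y, -, hxy⟩ := hE.exists_adj_compl hV (singleton_nonempty x) hx
  exact .inr ⟨[z, y], by simp [IsPathList, hxy, hxy.ne], rfl⟩

/-- A cycle on the vertices of a path that is not Hamiltonian is left by some edge, and opening the
cycle there gives a longer path. -/
theorem Expands.hasLongPath_length_add_one (hE : Expands G) (hV : 4 ≤ Fintype.card V)
    {l : List V} (hl : IsPathList G l) {x y : V} (hx : x ∈ l.getLast?) (hy : y ∈ l.head?)
    (hxy : G.Adj x y) : HasLongPath G (l.length + 1) := by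
  classical
  have hlen : #l.toFinset = l.length := List.toFinset_card_of_nodup hl.1
  by_cases hk : l.length = Fintype.card V
  · exact .inl ⟨l, hl, hk, x, hx, y, hy, hxy⟩
  have hne : l.toFinset ≠ univ := fun h ↦ hk (by rw [← hlen, h, card_univ])
  obtain ⟨u, hu, v, hv, huv⟩ := hE.exists_adj_compl hV
    ⟨y, List.mem_toFinset.2 (List.mem_of_mem_head? hy)⟩ hne
  rw [List.mem_toFinset] at hu hv
  obtain ⟨a, b, rfl⟩ := List.append_of_mem hu
  have hrotate := isPathList_append_comm hl hx hy (List.cons_ne_nil u b) hxy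
  refine .inr ⟨v :: ((u :: b) ++ a), ⟨List.nodup_cons.2 ⟨?_, hrotate.1⟩,
    List.isChain_cons_cons.2 ⟨huv.symm, hrotate.2⟩⟩, ?_⟩
  · rwa [List.perm_append_comm.mem_iff]
  · rw [List.length_cons, List.perm_append_comm.length_eq]

open scoped Classical in
/-- The pairs formed by the two ends of a path of `G` with `k` vertices. -/
noncomputable def pathEnds (G : SimpleGraph V) (k : ℕ) : Finset (V × V) :=
  {e | ∃ l, IsPathList G l ∧ l.length = k ∧ e.1 ∈ l.getLast? ∧ e.2 ∈ l.head?}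

theorem mem_pathEnds {k : ℕ} {x y : V} : (x, y) ∈ pathEnds G k ↔
    ∃ l, IsPathList G l ∧ l.length = k ∧ x ∈ l.getLast? ∧ y ∈ l.head? := by
  simp [pathEnds]

/-- Rotating a longest path at one end and then at the other one reaches many pairs of ends. -/
theorem Expands.card_sq_le_card_pathEnds (hE : Expands G) {P : List V} (hP : IsPathList G P)
    (hne : P ≠ []) (hmax : ∀ l, IsPathList G l → l.length ≠ P.length + 1) :
    Fintype.card V ^ 2 ≤ 16 * #(pathEnds G P.length) := by
  classical
  have hfiber : ∀ x ∈ endpoints G P,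
      Fintype.card V ≤ 4 * #{e ∈ pathEnds G P.length | e.1 = x} := fun x hx ↦ by
    obtain ⟨l, hl⟩ := mem_endpoints.1 hx
    have hQ : IsPathList G (x :: l).reverse := isPathList_reverse.2 (hl.isPathList hP)
    have hlen : (x :: l).reverse.length = P.length := by
      rw [List.length_reverse, hl.perm.length_eq]
    have hcard := hE.card_lt_four_mul_card_endpoints hQ (by simp) (hlen ▸ hmax)
    have hinj : #(endpoints G (x :: l).reverse) ≤ #{e ∈ pathEnds G P.length | e.1 = x} := by
      refine card_le_card_of_injOn (fun y ↦ (x, y)) (fun y hy ↦ ?_)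
        (Prod.mk_right_injective x).injOn
      obtain ⟨m, hm⟩ := mem_endpoints.1 hy
      refine mem_coe.2 (mem_filter.2 ⟨mem_pathEnds.2 ⟨y :: m, hm.isPathList hQ, ?_, ?_, rfl⟩, rfl⟩)
      · rw [hm.perm.length_eq, hlen]
      · simp [hm.getLast?_eq]
    lia
  have hcard := hE.card_lt_four_mul_card_endpoints hP hne hmax
  have hsum : ∑ x ∈ endpoints G P, #{e ∈ pathEnds G P.length | e.1 = x} ≤
      #(pathEnds G P.length) := by
    rw [card_eq_sum_card_fiberwise (f := Prod.fst) (t := univ) (by simp)]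
    exact sum_le_sum_of_subset (subset_univ _)
  have htotal := sum_le_sum hfiber
  rw [← mul_sum, sum_const, smul_eq_mul] at htotal
  nlinarith

theorem ne_of_mem_pathEnds {k : ℕ} (hk : 2 ≤ k) {x y : V} (h : (x, y) ∈ pathEnds G k) :
    x ≠ y := by
  rintro rfl
  obtain ⟨l, hl, rfl, hlast, hhead⟩ := mem_pathEnds.1 h
  match l, hl with
  | a :: b :: l, hl =>
    have hmem : (b :: l).getLast (by simp) ∈ b :: l := List.getLast_mem _
    simp_all [IsPathList, List.getLast?_eq_getLast_of_ne_nil]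

theorem Expands.hasLongPath_add_one_of_mem_pathEnds (hE : Expands G) (hV : 4 ≤ Fintype.card V)
    {k : ℕ} {x y : V} (h : (x, y) ∈ pathEnds G k) (hG : G ≤ G') (hxy : G'.Adj x y) :
    HasLongPath G' (k + 1) := by
  obtain ⟨l, hl, rfl, hx, hy⟩ := mem_pathEnds.1 h
  exact (hE.mono hG).hasLongPath_length_add_one hV (hl.mono hG) hx hy hxy

end Rotation

section RandomGraph

theorem one_sub_pow_le_inv_pow {q x : ℝ} (hq : q ≤ 1) (hx : 0 < x) {j k : ℕ}
    (h : j * Real.log x ≤ q * k) : (1 - q) ^ k ≤ (x ^ j)⁻¹ :=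
  calc (1 - q) ^ k ≤ Real.exp (-q) ^ k :=
        pow_le_pow_left₀ (sub_nonneg.2 hq) (Real.one_sub_le_exp_neg q) k
    _ = Real.exp (-(q * k)) := by rw [← Real.exp_nat_mul, mul_neg, mul_comm]
    _ ≤ Real.exp (-(j * Real.log x)) := by gcongr
    _ = (x ^ j)⁻¹ := by rw [Real.exp_neg, Real.exp_nat_mul, Real.exp_log hx]

variable {V : Type*}

/-- The graph whose edges are the unordered pairs selected by `ω`; selected loops are ignored. -/
def edgeGraph (ω : Sym2 V → Prop) : SimpleGraph V := .fromEdgeSet {e | ω e}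

theorem edgeGraph_adj {ω : Sym2 V → Prop} {x y : V} :
    (edgeGraph ω).Adj x y ↔ ω s(x, y) ∧ x ≠ y :=
  SimpleGraph.fromEdgeSet_adj _

theorem edgeGraph_mono : Monotone (edgeGraph (V := V)) := fun _ _ h ↦
  SimpleGraph.fromEdgeSet_mono h

theorem card_le_two_mul_card_image_sym2 [DecidableEq V] (B : Finset (V × V)) :
    #B ≤ 2 * #(B.image fun e ↦ s(e.1, e.2)) := by
  refine card_le_mul_card_image B 2 fun c _ ↦ ?_
  induction c using Sym2.ind with
  | _ x y =>
    refine (card_le_card (t := {(x, y), (y, x)}) fun e he ↦ ?_).trans card_le_two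
    simpa [Prod.ext_iff] using (mem_filter.1 he).2

variable [Fintype V]

theorem isUpperSet_hasHamiltonList :
    IsUpperSet {ω : Sym2 V → Prop | HasHamiltonList (edgeGraph ω)} :=
  fun _ _ h ↦ HasHamiltonList.mono (edgeGraph_mono h)

theorem card_image_sym2_product_compl [DecidableEq V] {S W : Finset V} (h : S ⊆ W) :
    #((S ×ˢ Wᶜ).image fun e ↦ s(e.1, e.2)) = #S * (Fintype.card V - #W) := by
  rw [card_image_of_injOn, card_product, card_compl]
  rintro ⟨a, b⟩ hab ⟨c, d⟩ hcd he
  simp only [coe_product, Set.mem_prod, mem_coe, mem_compl] at hab hcd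
  obtain ⟨rfl, rfl⟩ | ⟨rfl, rfl⟩ := Sym2.eq_iff.1 he
  · rfl
  · exact absurd (h hab.1) hcd.2

theorem bernoulliPi_real_forall_not_adj (q : I) {S W : Finset V} (h : S ⊆ W) :
    (bernoulliPi (Sym2 V) q).real {ω | ∀ x ∈ S, ∀ y ∉ W, ¬ (edgeGraph ω).Adj x y} =
      (1 - q : ℝ) ^ (#S * (Fintype.card V - #W)) := by
  classical
  rw [← card_image_sym2_product_compl h, ← bernoulliPi_real_forall_mem_not]
  congr 1
  ext ω
  simp only [Set.mem_ofPred_eq, edgeGraph_adj, forall_mem_image, mem_product, mem_compl,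
    Prod.forall, and_imp]
  have hne (x : V) (hx : x ∈ S) (y : V) (hy : y ∉ W) : x ≠ y := fun hxy ↦ hy (hxy ▸ h hx)
  grind

variable (V) in
open scoped Classical in
/-- The pairs of sets that can witness the failure of `Expands` at a set of `s` vertices. -/
noncomputable def expansionWitnesses (s : ℕ) : Finset (Finset V × Finset V) :=
  {e ∈ powersetCard s univ ×ˢ powersetCard (3 * s) univ | e.1 ⊆ e.2}

theorem mem_expansionWitnesses {s : ℕ} {e : Finset V × Finset V} :
    e ∈ expansionWitnesses V s ↔ (#e.1 = s ∧ #e.2 = 3 * s) ∧ e.1 ⊆ e.2 := by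
  simp [expansionWitnesses, mem_powersetCard]

theorem card_expansionWitnesses_le (s : ℕ) :
    #(expansionWitnesses V s) ≤ Fintype.card V ^ (4 * s) := by
  calc #(expansionWitnesses V s) ≤ (Fintype.card V).choose s * (Fintype.card V).choose (3 * s) := by
        classical
        exact (card_filter_le _ _).trans_eq (by simp [card_powersetCard])
    _ ≤ Fintype.card V ^ s * Fintype.card V ^ (3 * s) :=
        Nat.mul_le_mul (Nat.choose_le_pow _ _) (Nat.choose_le_pow _ _)
    _ = Fintype.card V ^ (4 * s) := by ring

theorem exists_expansionWitness_of_not_expands {G : SimpleGraph V} (hG : ¬ Expands G) :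
    ∃ s ∈ Icc 1 (Fintype.card V / 4), ∃ e ∈ expansionWitnesses V s,
      ∀ x ∈ e.1, ∀ y ∉ e.2, ¬ G.Adj x y := by
  simp only [Expands, not_forall, not_exists, not_and] at hG
  obtain ⟨S, W, hS, hcard, hSW, hW, hno⟩ := hG
  obtain ⟨W', hWW', hW'⟩ := exists_superset_card_eq hW (by lia)
  have := hS.card_pos
  exact ⟨#S, mem_Icc.2 (by lia), (S, W'), mem_expansionWitnesses.2 ⟨⟨rfl, hW'⟩, hSW.trans hWW'⟩,
    fun x hx y hy ↦ hno x hx y (mt (@hWW' y) hy)⟩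

theorem one_sub_pow_mul_sub_le_inv_pow {n s : ℕ} (hs : s ∈ Icc 1 (n / 4)) {q : I}
    (hq : 24 * Real.log n ≤ q * n) : (1 - q : ℝ) ^ (s * (n - 3 * s)) ≤ ((n : ℝ) ^ (6 * s))⁻¹ := by
  rw [mem_Icc] at hs
  refine one_sub_pow_le_inv_pow q.2.2 (by norm_cast; lia) ?_
  have hquarter : (n : ℝ) ≤ 4 * (n - 3 * s : ℕ) := by norm_cast; lia
  have hlog : 6 * Real.log n ≤ q * (n - 3 * s : ℕ) := by
    have := mul_le_mul_of_nonneg_left hquarter q.2.1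
    linarith
  calc (6 * s : ℕ) * Real.log n = s * (6 * Real.log n) := by push_cast; ring
    _ ≤ s * (q * (n - 3 * s : ℕ)) := by gcongr
    _ = q * (s * (n - 3 * s) : ℕ) := by push_cast; ring

theorem sum_expansionWitnesses_real_le {q : I} (hq : 24 * Real.log (Fintype.card V) ≤
    q * Fintype.card V) {s : ℕ} (hs : s ∈ Icc 1 (Fintype.card V / 4)) :
    ∑ e ∈ expansionWitnesses V s, (bernoulliPi (Sym2 V) q).real
      {ω | ∀ x ∈ e.1, ∀ y ∉ e.2, ¬ (edgeGraph ω).Adj x y} ≤ ((Fintype.card V : ℝ) ^ 2)⁻¹ := by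
  set n := Fintype.card V
  have hs' := mem_Icc.1 hs
  have hn : (1 : ℝ) ≤ n := by norm_cast; lia
  calc ∑ e ∈ expansionWitnesses V s, (bernoulliPi (Sym2 V) q).real
        {ω | ∀ x ∈ e.1, ∀ y ∉ e.2, ¬ (edgeGraph ω).Adj x y}
      ≤ ∑ _e ∈ expansionWitnesses V s, ((n : ℝ) ^ (6 * s))⁻¹ := by
        refine sum_le_sum fun e he ↦ ?_
        obtain ⟨⟨hS, hW⟩, hSW⟩ := mem_expansionWitnesses.1 he
        rw [bernoulliPi_real_forall_not_adj q hSW, hS, hW]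
        exact one_sub_pow_mul_sub_le_inv_pow hs hq
    _ ≤ (n : ℝ) ^ (4 * s) * ((n : ℝ) ^ (6 * s))⁻¹ := by
        rw [sum_const, nsmul_eq_mul]
        gcongr
        exact mod_cast card_expansionWitnesses_le s
    _ = ((n : ℝ) ^ (2 * s))⁻¹ := by
        rw [show 6 * s = 4 * s + 2 * s by ring, pow_add]
        field_simp
    _ ≤ ((n : ℝ) ^ 2)⁻¹ := by
        gcongr
        lia

theorem bernoulliPi_real_not_expands_le (hV : 4 ≤ Fintype.card V) {q : I}
    (hq : 24 * Real.log (Fintype.card V) ≤ q * Fintype.card V) :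
    (bernoulliPi (Sym2 V) q).real {ω | ¬ Expands (edgeGraph ω)} ≤ (Fintype.card V : ℝ)⁻¹ := by
  set n := Fintype.card V
  have : (0 : ℝ) < n := by norm_cast; lia
  set N : Finset V × Finset V → Set (Sym2 V → Prop) :=
    fun e ↦ {ω | ∀ x ∈ e.1, ∀ y ∉ e.2, ¬ (edgeGraph ω).Adj x y}
  calc (bernoulliPi (Sym2 V) q).real {ω | ¬ Expands (edgeGraph ω)}
      ≤ (bernoulliPi (Sym2 V) q).real (⋃ s ∈ Icc 1 (n / 4), ⋃ e ∈ expansionWitnesses V s, N e) := by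
        refine measureReal_mono (fun ω hω ↦ ?_) (measure_ne_top _ _)
        simpa only [N, Set.mem_iUnion, Set.mem_ofPred_eq, exists_prop] using
          exists_expansionWitness_of_not_expands hω
    _ ≤ ∑ s ∈ Icc 1 (n / 4), ∑ e ∈ expansionWitnesses V s, (bernoulliPi (Sym2 V) q).real (N e) :=
        (measureReal_biUnion_finset_le _ _).trans
          (sum_le_sum fun s _ ↦ measureReal_biUnion_finset_le _ _)
    _ ≤ ∑ _s ∈ Icc 1 (n / 4), ((n : ℝ) ^ 2)⁻¹ :=
        sum_le_sum fun s hs ↦ sum_expansionWitnesses_real_le hq hs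
    _ ≤ n * ((n : ℝ) ^ 2)⁻¹ := by
        rw [sum_const, nsmul_eq_mul, Nat.card_Icc]
        gcongr
        lia
    _ = (n : ℝ)⁻¹ := by field_simp

theorem bernoulliPi_real_not_hasLongPath_sup_le (hV : 4 ≤ Fintype.card V) {q : I}
    (hq : 64 * Real.log (Fintype.card V) ≤ q * (Fintype.card V : ℝ) ^ 2) {k : ℕ} (hk : 2 ≤ k)
    {a : Sym2 V → Prop} (hE : Expands (edgeGraph a)) (hpath : HasLongPath (edgeGraph a) k) :
    (bernoulliPi (Sym2 V) q).real {b | ¬ HasLongPath (edgeGraph (a ⊔ b)) (k + 1)} ≤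
      ((Fintype.card V : ℝ) ^ 2)⁻¹ := by
  classical
  set n := Fintype.card V
  have hmono (b : Sym2 V → Prop) : edgeGraph a ≤ edgeGraph (a ⊔ b) := edgeGraph_mono le_sup_left
  by_cases hlonger : HasLongPath (edgeGraph a) (k + 1)
  · have hempty : {b | ¬ HasLongPath (edgeGraph (a ⊔ b)) (k + 1)} = ∅ :=
      Set.eq_empty_of_forall_notMem fun b hb ↦ hb (hlonger.mono (hmono b))
    rw [hempty, measureReal_empty]
    positivity
  obtain ⟨P, hP, rfl⟩ := hpath.resolve_left fun h ↦ hlonger (.inl h)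
  have hcard := hE.card_sq_le_card_pathEnds hP (List.ne_nil_of_length_pos (by lia))
    fun l hl hlen ↦ hlonger (.inr ⟨l, hl, hlen⟩)
  set C := (pathEnds (edgeGraph a) P.length).image fun e ↦ s(e.1, e.2)
  have hC : (n : ℝ) ^ 2 ≤ 32 * #C := by
    have := card_le_two_mul_card_image_sym2 (pathEnds (edgeGraph a) P.length)
    norm_cast
    lia
  calc (bernoulliPi (Sym2 V) q).real {b | ¬ HasLongPath (edgeGraph (a ⊔ b)) (P.length + 1)}
      ≤ (bernoulliPi (Sym2 V) q).real {b | ∀ c ∈ C, ¬ b c} := by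
        refine measureReal_mono fun b hb ↦ forall_mem_image.2 fun ⟨x, y⟩ hxy hbxy ↦ hb ?_
        exact hE.hasLongPath_add_one_of_mem_pathEnds hV hxy (hmono b)
          (edgeGraph_adj.2 ⟨.inr hbxy, ne_of_mem_pathEnds hk hxy⟩)
    _ = (1 - q : ℝ) ^ #C := bernoulliPi_real_forall_mem_not C q
    _ ≤ ((n : ℝ) ^ 2)⁻¹ := by
        refine one_sub_pow_le_inv_pow q.2.2 (by norm_cast; lia) ?_
        have := mul_le_mul_of_nonneg_left hC q.2.1
        push_cast
        linarith

theorem bernoulliPi_real_not_expands_and_hasLongPath_le (hV : 4 ≤ Fintype.card V) {q₁ q₂ : I}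
    (hq₁ : 24 * Real.log (Fintype.card V) ≤ q₁ * Fintype.card V)
    (hq₂ : 64 * Real.log (Fintype.card V) ≤ q₂ * (Fintype.card V : ℝ) ^ 2) (k : ℕ) :
    (bernoulliPi (Sym2 V) (σ (σ q₁ * σ q₂ ^ k))).real
        {ω | ¬ (Expands (edgeGraph ω) ∧ HasLongPath (edgeGraph ω) (k + 2))} ≤
      (Fintype.card V : ℝ)⁻¹ + k * ((Fintype.card V : ℝ) ^ 2)⁻¹ := by
  induction k with
  | zero =>
    have hbad : {ω : Sym2 V → Prop | ¬ (Expands (edgeGraph ω) ∧ HasLongPath (edgeGraph ω) 2)} =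
        {ω | ¬ Expands (edgeGraph ω)} := by
      ext ω
      exact not_congr (and_iff_left_of_imp fun hE ↦ hE.hasLongPath_two hV)
    simp only [pow_zero, mul_one, unitInterval.symm_symm, Nat.cast_zero, zero_mul, add_zero,
      zero_add]
    rw [hbad]
    exact bernoulliPi_real_not_expands_le hV hq₁
  | succ k ih =>
    have hsup := measurePreserving_sup_bernoulliPi (ι := Sym2 V)
      (p := σ (σ q₁ * σ q₂ ^ (k + 1))) (p₁ := σ (σ q₁ * σ q₂ ^ k)) (p₂ := q₂)
      (by simp only [unitInterval.symm_symm, pow_succ, mul_assoc])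
    rw [← hsup.measureReal_preimage MeasurableSet.of_discrete.nullMeasurableSet]
    refine (prod_real_le_add .of_discrete .of_discrete
      (δ := ((Fintype.card V : ℝ) ^ 2)⁻¹) (by positivity) fun a ha ↦ ?_).trans
      ((add_le_add_left ih _).trans_eq (by push_cast; ring))
    obtain ⟨hE, hpath⟩ := not_not.1 ha
    have hbad : Prod.mk a ⁻¹' ((fun ω : (Sym2 V → Prop) × (Sym2 V → Prop) ↦ ω.1 ⊔ ω.2) ⁻¹'
        {ω | ¬ (Expands (edgeGraph ω) ∧ HasLongPath (edgeGraph ω) (k + 1 + 2))}) =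
        {b | ¬ HasLongPath (edgeGraph (a ⊔ b)) (k + 2 + 1)} := by
      ext b
      exact not_congr (and_iff_right (hE.mono (edgeGraph_mono le_sup_left)))
    rw [hbad]
    exact bernoulliPi_real_not_hasLongPath_sup_le hV hq₂ (by lia) hE hpath

theorem symm_symm_mul_symm_pow_le (q₁ q₂ : I) (n : ℕ) :
    (σ (σ q₁ * σ q₂ ^ n) : ℝ) ≤ q₁ + n * q₂ := by
  have hbernoulli := one_add_mul_le_pow (a := -(q₂ : ℝ)) (by linarith [q₂.2.2]) n
  have hprod := mul_le_mul_of_nonneg_left hbernoulli (σ q₁).2.1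
  have hcross : 0 ≤ (q₁ : ℝ) * (n * q₂) := mul_nonneg q₁.2.1 (mul_nonneg n.cast_nonneg q₂.2.1)
  simp only [unitInterval.coe_symm_eq, Set.Icc.coe_mul, Set.Icc.coe_pow] at hprod ⊢
  rw [← sub_eq_add_neg] at hprod
  linarith

theorem exists_symm_symm_mul_symm_pow_le {n : ℕ} (hn : n ≠ 0) {q : I}
    (hq : 88 * Real.log n / n ≤ q) : ∃ q₁ q₂ : I, 24 * Real.log n ≤ q₁ * n ∧
      64 * Real.log n ≤ q₂ * n ^ 2 ∧ σ (σ q₁ * σ q₂ ^ n) ≤ q := by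
  have hn1 : (1 : ℝ) ≤ n := mod_cast Nat.one_le_iff_ne_zero.2 hn
  have : 0 ≤ Real.log n := Real.log_nonneg hn1
  have hle₁ : 24 * Real.log n / n ≤ 88 * Real.log n / n := by
    gcongr
    norm_num
  have hle₂ : 64 * Real.log n / n ^ 2 ≤ 88 * Real.log n / n := by
    gcongr
    · norm_num
    · exact le_self_pow₀ hn1 two_ne_zero
  refine ⟨⟨24 * Real.log n / n, by positivity, (hle₁.trans hq).trans q.2.2⟩,
    ⟨64 * Real.log n / n ^ 2, by positivity, (hle₂.trans hq).trans q.2.2⟩,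
    (div_mul_cancel₀ _ (by positivity)).ge, (div_mul_cancel₀ _ (by positivity)).ge,
    Subtype.coe_le_coe.1 ((symm_symm_mul_symm_pow_le _ _ n).trans (hq.trans' (le_of_eq ?_)))⟩
  field_simp
  norm_num

/-- The binomial random graph is Hamiltonian above the logarithmic threshold: first expose a graph
that expands, then lengthen its longest path in `card V` rounds of sprinkling. -/
theorem bernoulliPi_real_not_hasHamiltonList_le (hV : 4 ≤ Fintype.card V) {q : I}
    (hq : 88 * Real.log (Fintype.card V) / Fintype.card V ≤ q) :
    (bernoulliPi (Sym2 V) q).real {ω | ¬ HasHamiltonList (edgeGraph ω)} ≤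
      2 / (Fintype.card V : ℝ) := by
  set n := Fintype.card V
  obtain ⟨q₁, q₂, hq₁, hq₂, hle⟩ := exists_symm_symm_mul_symm_pow_le (n := n) (by lia) hq
  calc (bernoulliPi (Sym2 V) q).real {ω | ¬ HasHamiltonList (edgeGraph ω)}
      ≤ (bernoulliPi (Sym2 V) (σ (σ q₁ * σ q₂ ^ n))).real
          {ω | ¬ HasHamiltonList (edgeGraph ω)} := by
        have hmono := bernoulliPi_real_mono hle (isUpperSet_hasHamiltonList (V := V))
        rw [← Set.compl_ofPred, probReal_compl_eq_one_sub .of_discrete,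
          probReal_compl_eq_one_sub .of_discrete]
        linarith
    _ ≤ (bernoulliPi (Sym2 V) (σ (σ q₁ * σ q₂ ^ n))).real
          {ω | ¬ (Expands (edgeGraph ω) ∧ HasLongPath (edgeGraph ω) (n + 2))} :=
        measureReal_mono fun ω hω h ↦ hω (h.2.hasHamiltonList (by lia))
    _ ≤ (n : ℝ)⁻¹ + n * ((n : ℝ) ^ 2)⁻¹ :=
        bernoulliPi_real_not_expands_and_hasLongPath_le hV hq₁ hq₂ n
    _ = 2 / (n : ℝ) := by
        field_simp
        norm_num

end RandomGraph

section Coupling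

variable {ι : Type*} [DecidableEq ι]

/-- The reindexing of pairs of coins under which both coins of a pair outside `s` read its first
coin. -/
def identifyCoins (s : Finset ι) : ι ⊕ ι → ι ⊕ ι :=
  Sum.elim .inl fun i ↦ if i ∈ s then .inr i else .inl i

theorem comp_identifyCoins_insert (ω : ι ⊕ ι → Prop) (s : Finset ι) (i : ι) :
    ω ∘ identifyCoins (insert i s) =
      Function.update (ω ∘ identifyCoins s) (.inr i) (ω (.inr i)) := by
  ext (j | j) <;> simp [identifyCoins, Function.update_apply]
  grind

theorem comp_swap_comp_identifyCoins (ω : ι ⊕ ι → Prop) {s : Finset ι} {i : ι} (hi : i ∉ s) :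
    (ω ∘ Equiv.swap (.inl i) (.inr i)) ∘ identifyCoins s = Function.update
      (Function.update (ω ∘ identifyCoins s) (.inl i) (ω (.inr i))) (.inr i) (ω (.inr i)) := by
  ext (j | j) <;> simp [identifyCoins, Function.update_apply, Equiv.swap_apply_def] <;> grind

theorem comp_swap_comp_identifyCoins_insert (ω : ι ⊕ ι → Prop) {s : Finset ι} {i : ι}
    (hi : i ∉ s) : (ω ∘ Equiv.swap (.inl i) (.inr i)) ∘ identifyCoins (insert i s) =
      Function.update (ω ∘ identifyCoins s) (.inl i) (ω (.inr i)) := by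
  ext (j | j) <;> simp [identifyCoins, Function.update_apply, Equiv.swap_apply_def] <;> grind

theorem update_mem_and_update_update_notMem {κ : Type*} [DecidableEq κ]
    {S : Set (κ → Prop)} (hS : IsUpperSet S) {k l : κ}
    (hpair : ∀ ω ∈ S, Function.update ω k False ∈ S ∨ Function.update ω l False ∈ S)
    {ω : κ → Prop} {a : Prop} (hω : ω ∈ S) (hl : Function.update ω l a ∉ S) :
    Function.update ω k a ∈ S ∧ Function.update (Function.update ω k a) l a ∉ S := by
  have ha : a = False := eq_false fun ha ↦
    hl (hS (le_update_iff.2 ⟨fun _ ↦ ha, fun _ _ ↦ le_rfl⟩) hω)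
  subst ha
  refine ⟨(hpair ω hω).resolve_right hl, fun h ↦ hl (hS ?_ h)⟩
  have hle : Function.update ω k False ≤ ω := update_le_self_iff.2 False.elim
  exact update_le_update_iff.2 ⟨le_rfl, fun j _ ↦ hle j⟩

variable [Fintype ι]

theorem bernoulliPi_real_comp_identifyCoins_mem_le (p : I) {S : Set (ι ⊕ ι → Prop)}
    (hS : IsUpperSet S)
    (hpair : ∀ i, ∀ ω ∈ S,
      Function.update ω (.inl i) False ∈ S ∨ Function.update ω (.inr i) False ∈ S)
    (s : Finset ι) {i : ι} (hi : i ∉ s) :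
    (bernoulliPi (ι ⊕ ι) p).real {ω | ω ∘ identifyCoins s ∈ S} ≤
      (bernoulliPi (ι ⊕ ι) p).real {ω | ω ∘ identifyCoins (insert i s) ∈ S} := by
  set A := {ω : ι ⊕ ι → Prop | ω ∘ identifyCoins s ∈ S}
  set B := {ω : ι ⊕ ι → Prop | ω ∘ identifyCoins (insert i s) ∈ S}
  have hswap := measurePreserving_comp_bernoulliPi
    (Equiv.swap (.inl i) (.inr i) : Equiv.Perm (ι ⊕ ι)).injective p
  have hsub : A \ B ⊆ (fun ω ↦ ω ∘ Equiv.swap (.inl i) (.inr i)) ⁻¹' (B \ A) := by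
    rintro ω ⟨hωA, hωB⟩
    rw [Set.mem_ofPred_eq, comp_identifyCoins_insert] at hωB
    have := update_mem_and_update_update_notMem hS (hpair i) hωA hωB
    rwa [← comp_swap_comp_identifyCoins ω hi, ← comp_swap_comp_identifyCoins_insert ω hi] at this
  have hdiff : (bernoulliPi (ι ⊕ ι) p).real (A \ B) ≤ (bernoulliPi (ι ⊕ ι) p).real (B \ A) :=
    (measureReal_mono hsub).trans_eq
      (hswap.measureReal_preimage MeasurableSet.of_discrete.nullMeasurableSet)
  have hA := measureReal_inter_add_sdiff (μ := bernoulliPi (ι ⊕ ι) p) (s := A) (t := B) .of_discrete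
  have hB := measureReal_inter_add_sdiff (μ := bernoulliPi (ι ⊕ ι) p) (s := B) (t := A) .of_discrete
  rw [Set.inter_comm] at hB
  linarith

/-- McDiarmid's coupling: making the two coins of every pair independent favours an increasing event
that never needs both coins of a pair, because swapping the coins of a pair maps the outcomes that
are lost to outcomes that are gained. -/
theorem bernoulliPi_real_elim_mem_le (p : I) {S : Set (ι ⊕ ι → Prop)} (hS : IsUpperSet S)
    (hpair : ∀ i, ∀ ω ∈ S,
      Function.update ω (.inl i) False ∈ S ∨ Function.update ω (.inr i) False ∈ S) :
    (bernoulliPi ι p).real {ω | Sum.elim ω ω ∈ S} ≤ (bernoulliPi (ι ⊕ ι) p).real S := by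
  have hempty : {ω : ι ⊕ ι → Prop | ω ∘ identifyCoins ∅ ∈ S} =
      (fun ω ↦ ω ∘ Sum.inl) ⁻¹' {ω | Sum.elim ω ω ∈ S} := by
    ext ω
    simp only [Set.mem_ofPred_eq, Set.mem_preimage]
    congr! 1
    ext (i | i) <;> rfl
  have huniv : {ω : ι ⊕ ι → Prop | ω ∘ identifyCoins univ ∈ S} = S := by
    ext ω
    simp only [Set.mem_ofPred_eq]
    congr! 1
    ext (i | i) <;> simp [identifyCoins]
  have hinl := measurePreserving_comp_bernoulliPi (Sum.inl_injective (α := ι) (β := ι)) p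
  rw [← hinl.measureReal_preimage MeasurableSet.of_discrete.nullMeasurableSet, ← hempty]
  nth_rw 2 [← huniv]
  induction (univ : Finset ι) using Finset.induction_on with
  | empty => rfl
  | insert i s hi ih => exact ih.trans (bernoulliPi_real_comp_identifyCoins_mem_le p hS hpair s hi)

end Coupling

section RandomDigraph

variable {V : Type*}

theorem HasHamiltonList.nonempty_cyclesIn [Fintype V] {G : SimpleGraph V} (hG : HasHamiltonList G) :
    (cyclesIn fun e ↦ G.Adj e.1 e.2).Nonempty := by
  classical
  obtain ⟨l, ⟨hnodup, hchain⟩, hlen, x, hx, y, hy, hxy⟩ := hG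
  have hmem : ∀ z, z ∈ l := fun z ↦ List.mem_toFinset.1 <|
    (card_eq_iff_eq_univ _).1 ((List.toFinset_card_of_nodup hnodup).trans hlen) ▸ mem_univ z
  refine ⟨l.formPerm, mem_cyclesIn.2 ⟨?_, fun z ↦ ?_⟩⟩
  · exact isCycleOn_univ_iff.2 fun a b ↦ hnodup.isCycleOn_formPerm.2 (hmem a) (hmem b)
  obtain ⟨i, hi, rfl⟩ := List.getElem_of_mem (hmem z)
  obtain hlt | hlast : i + 1 < l.length ∨ i = l.length - 1 := by lia
  · rw [List.formPerm_apply_lt_getElem l hnodup i hlt]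
    exact List.isChain_iff_getElem.1 hchain i hlt
  · obtain ⟨l, rfl⟩ := List.head?_eq_some_iff.1 hy
    obtain rfl : x = (y :: l)[i] := by
      rw [Option.mem_def, List.getLast?_eq_getElem?, ← hlast, List.getElem?_eq_getElem hi] at hx
      exact (Option.some.inj hx).symm
    have hformPerm : (y :: l).formPerm (y :: l)[i] = y := by
      simp only [hlast]
      rw [← List.getLast_eq_getElem (List.cons_ne_nil y l), List.formPerm_apply_getLast]
    rwa [hformPerm]

variable [LinearOrder V]

/-- The pair of vertices joined by an arc, in one of two copies according to the direction of the
arc. -/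
def orient (e : V × V) : Sym2 V ⊕ Sym2 V :=
  if e.1 < e.2 then .inl s(e.1, e.2) else .inr s(e.1, e.2)

theorem orient_injective : (orient (V := V)).Injective := by
  rintro ⟨x, y⟩ ⟨x', y'⟩ h
  simp only [orient] at h
  grind [Sym2.eq_iff]

variable [Fintype V]

theorem update_comp_orient_mem_cyclesIn {ω : Sym2 V ⊕ Sym2 V → Prop} {π : Equiv.Perm V}
    (hπ : π ∈ cyclesIn (ω ∘ orient)) {c : Sym2 V ⊕ Sym2 V} (hc : ∀ x, orient (x, π x) ≠ c) :
    π ∈ cyclesIn (Function.update ω c False ∘ orient) := by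
  rw [mem_cyclesIn] at hπ ⊢
  refine hπ.imp_right fun h x ↦ ?_
  rw [Function.comp, Function.update_of_ne (hc x)]
  exact h x

theorem orient_ne_inr_of_orient_eq_inl {π : Equiv.Perm V} (hπ : π.IsCycleOn Set.univ)
    (hV : 3 ≤ Fintype.card V) {c : Sym2 V} {x : V} (hx : orient (x, π x) = .inl c) (y : V) :
    orient (y, π y) ≠ .inr c := by
  intro hy
  have hππ : π (π x) ≠ x := fun h ↦ by
    have hdvd := (Equiv.Perm.IsCycleOn.pow_apply_eq (s := univ) (n := 2)
      (by rwa [coe_univ]) (mem_univ x)).1 (by simpa [sq] using h)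
    exact absurd (Nat.le_of_dvd two_pos hdvd) (by rw [card_univ]; lia)
  simp only [orient] at hx hy
  grind [Sym2.eq_iff]

/-- The binomial random digraph is Hamiltonian above the logarithmic threshold: by McDiarmid's
coupling it is at least as likely to be so as the random graph with the same density. -/
theorem bernoulliPi_real_not_nonempty_cyclesIn_le (hV : 4 ≤ Fintype.card V) {q : I}
    (hq : 88 * Real.log (Fintype.card V) / Fintype.card V ≤ q) :
    (bernoulliPi (V × V) q).real {ω | ¬ (cyclesIn ω).Nonempty} ≤ 2 / (Fintype.card V : ℝ) := by
  set S := {ω : Sym2 V ⊕ Sym2 V → Prop | (cyclesIn (ω ∘ orient)).Nonempty}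
  have hS : IsUpperSet S := fun ω ω' hω h ↦ h.mono (cyclesIn_mono fun e ↦ hω (orient e))
  have hpair (c : Sym2 V) (ω) (hω : ω ∈ S) :
      Function.update ω (.inl c) False ∈ S ∨ Function.update ω (.inr c) False ∈ S := by
    obtain ⟨π, hπ⟩ := hω
    by_cases hc : ∀ x, orient (x, π x) ≠ .inl c
    · exact .inl ⟨π, update_comp_orient_mem_cyclesIn hπ hc⟩
    · obtain ⟨x, hx⟩ := not_forall_not.1 hc
      exact .inr ⟨π, update_comp_orient_mem_cyclesIn hπ
        (orient_ne_inr_of_orient_eq_inl (mem_cyclesIn.1 hπ).1 (by lia) hx)⟩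
  have hgraph : (bernoulliPi (Sym2 V) q).real {ω | HasHamiltonList (edgeGraph ω)} ≤
      (bernoulliPi (Sym2 V) q).real {ω | Sum.elim ω ω ∈ S} :=
    measureReal_mono fun ω hω ↦ hω.nonempty_cyclesIn.mono <| cyclesIn_mono fun e he ↦ by
      have := (edgeGraph_adj.1 he).1
      simp only [Function.comp, orient]
      split_ifs <;> exact this
  have hcoupling := bernoulliPi_real_elim_mem_le q hS hpair
  have hdigraph : (bernoulliPi (Sym2 V ⊕ Sym2 V) q).real S =
      (bernoulliPi (V × V) q).real {ω | (cyclesIn ω).Nonempty} :=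
    (measurePreserving_comp_bernoulliPi orient_injective q).measureReal_preimage
      (s := {ω | (cyclesIn ω).Nonempty}) MeasurableSet.of_discrete.nullMeasurableSet
  have hnot := bernoulliPi_real_not_hasHamiltonList_le hV hq
  rw [← Set.compl_ofPred, probReal_compl_eq_one_sub .of_discrete] at hnot ⊢
  linarith

end RandomDigraph

section Completion

open Equiv (Perm)

variable {V : Type*}

theorem sameCycle_pow_apply_of_forall_notMem {π ρ : Perm V} {R : Finset V}
    (h : ∀ x ∉ R, ρ x = π x) {x : V} {n : ℕ} (hx : ∀ i < n, (π ^ i) x ∉ R) :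
    ρ.SameCycle x ((π ^ n) x) := by
  induction n with
  | zero => exact .refl ρ x
  | succ n ih =>
    rw [pow_succ', Perm.mul_apply, ← h _ (hx n n.lt_succ_self)]
    exact (ih fun i hi ↦ hx i (by lia)).apply_right

section PrevVisit

variable [Finite V]

theorem exists_prevVisit (π : Perm V) (R : Finset V) (z : R) :
    ∃ y : R, ∃ n, (π ^ n) (π y) = z ∧ ∀ i < n, (π ^ i) (π y) ∉ R := by
  classical
  have hex : ∃ n, (π⁻¹ ^ (n + 1)) z ∈ R :=
    ⟨orderOf π - 1, by simp [Nat.sub_add_cancel (orderOf_pos π), pow_orderOf_eq_one]⟩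
  have hpow (i d : ℕ) : (π ^ i) (π ((π⁻¹ ^ (i + d + 1)) z)) = (π⁻¹ ^ d) z := by
    rw [← Perm.mul_apply, ← Perm.mul_apply, ← pow_succ, add_right_comm, pow_add _ (i + 1),
      ← mul_assoc, inv_pow, mul_inv_cancel, one_mul]
  refine ⟨⟨_, Nat.find_spec hex⟩, Nat.find hex, ?_, fun i hi ↦ ?_⟩
  · simpa using hpow (Nat.find hex) 0
  · obtain ⟨d, hd⟩ := Nat.exists_eq_add_of_lt hi
    have hvisit := hpow i (d + 1)
    rw [← add_assoc, ← hd] at hvisit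
    rw [hvisit]
    exact Nat.find_min hex (m := d) (by lia)

/-- The element of `R` visited by `π` last before `z`. -/
noncomputable def prevVisit (π : Perm V) (R : Finset V) (z : R) : R :=
  (exists_prevVisit π R z).choose

theorem prevVisit_spec (π : Perm V) (R : Finset V) (z : R) :
    ∃ n, (π ^ n) (π (prevVisit π R z)) = z ∧ ∀ i < n, (π ^ i) (π (prevVisit π R z)) ∉ R :=
  (exists_prevVisit π R z).choose_spec

theorem prevVisit_injective (π : Perm V) (R : Finset V) : (prevVisit π R).Injective := by
  intro z z' h
  obtain ⟨m, hm, hm'⟩ := prevVisit_spec π R z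
  obtain ⟨n, hn, hn'⟩ := prevVisit_spec π R z'
  rw [← h] at hn hn'
  obtain hlt | rfl | hlt := lt_trichotomy m n
  · exact absurd (hm ▸ z.2) (hn' m hlt)
  · exact Subtype.ext (hm.symm.trans hn)
  · exact absurd (hn ▸ z'.2) (hm' n hlt)

end PrevVisit

variable [Fintype V] [DecidableEq V]

/-- Cut the cycles of `π` at their visits to `R` and rejoin the resulting paths in the order
prescribed by `τ`, where each path is represented by its last vertex. -/
noncomputable def rejoin (π : Perm V) {R : Finset V} (τ : Perm R) : Perm V :=
  π * Perm.ofSubtype (Equiv.ofBijective _ (prevVisit_injective π R).bijective_of_finite * τ)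

variable {π : Perm V} {R : Finset V} {τ : Perm R}

theorem rejoin_apply_of_notMem {x : V} (hx : x ∉ R) : rejoin π τ x = π x := by
  rw [rejoin, Perm.mul_apply, Perm.ofSubtype_apply_of_not_mem _ hx]

theorem rejoin_apply_coe (x : R) : rejoin π τ x = π (prevVisit π R (τ x)) := by
  rw [rejoin, Perm.mul_apply, Perm.ofSubtype_apply_coe]
  rfl

theorem isCycleOn_rejoin (hπ : π.IsCycleOn Set.univ) (hR : R.Nonempty)
    (hτ : τ.IsCycleOn Set.univ) : (rejoin π τ).IsCycleOn Set.univ := by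
  rw [isCycleOn_univ_iff] at hπ hτ ⊢
  have hstep (x : R) : (rejoin π τ).SameCycle x (τ x) := by
    obtain ⟨n, hn, hn'⟩ := prevVisit_spec π R (τ x)
    rw [← Perm.sameCycle_apply_left, rejoin_apply_coe]
    exact hn ▸ sameCycle_pow_apply_of_forall_notMem (fun _ ↦ rejoin_apply_of_notMem) hn'
  have hR_same (x y : R) : (rejoin π τ).SameCycle x y := by
    obtain ⟨k, rfl⟩ := (hτ x y).exists_nat_pow_eq
    induction k with
    | zero => exact .refl _ _
    | succ k ih =>
      rw [pow_succ', Perm.mul_apply]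
      exact ih.trans (hstep _)
  have hreach (v : V) : ∃ x : R, (rejoin π τ).SameCycle v x := by
    obtain ⟨r, hr⟩ := hR
    have hex : ∃ k : ℕ, (π ^ k) v ∈ R := (hπ v r).exists_nat_pow_eq.imp fun _ hk ↦ by rwa [hk]
    exact ⟨⟨_, Nat.find_spec hex⟩, sameCycle_pow_apply_of_forall_notMem
      (fun _ ↦ rejoin_apply_of_notMem) fun i ↦ Nat.find_min hex⟩
  intro x y
  obtain ⟨a, ha⟩ := hreach x
  obtain ⟨b, hb⟩ := hreach y
  exact (ha.trans (hR_same a b)).trans hb.symm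

theorem card_filter_exists_mem_forall_notMem_eq_le (C D : Finset (Perm V)) (R : Finset V) :
    #{π ∈ C | ∃ ρ ∈ D, ∀ x ∉ R, ρ x = π x} ≤ (#R)! * #D := by
  have hagree (ρ : Perm V) : #{π : Perm V | ∀ x ∈ Rᶜ, π x = ρ x} ≤ (#R)! := by
    simpa [card_compl, Nat.sub_sub_self (card_le_univ R)] using
      card_filter_forall_mem_perm_eq_le ρ Rᶜ
  calc #{π ∈ C | ∃ ρ ∈ D, ∀ x ∉ R, ρ x = π x}
      ≤ #(D.biUnion fun ρ ↦ {π : Perm V | ∀ x ∈ Rᶜ, π x = ρ x}) := by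
        refine card_le_card fun π hπ ↦ ?_
        simp only [mem_filter, mem_biUnion, mem_univ, mem_compl, true_and] at hπ ⊢
        exact hπ.2.imp fun ρ hρ ↦ hρ.imp_right fun h x hx ↦ (h x hx).symm
    _ ≤ (#R)! * #D := by
        rw [mul_comm]
        exact card_biUnion_le_card_mul _ _ _ fun ρ _ ↦ hagree ρ

theorem bernoulliPi_real_not_exists_mem_cyclesIn_sup_le {V : Type*} [Fintype V] [LinearOrder V]
    {π : Perm V} {R : Finset V} (hR : 4 ≤ #R) {q : I} (hq : 88 * Real.log #R / #R ≤ q)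
    (hπ : π.IsCycleOn Set.univ) {A : V × V → Prop} (hA : ∀ x ∉ R, A (x, π x)) :
    (bernoulliPi (V × V) q).real {b | ¬ ∃ ρ ∈ cyclesIn (A ⊔ b), ∀ x ∉ R, ρ x = π x} ≤
      2 / (#R : ℝ) := by
  let g : R × R → V × V := fun e ↦ (e.1, π (prevVisit π R e.2))
  have hg : g.Injective := fun e e' h ↦ Prod.ext (Subtype.ext (congrArg Prod.fst h))
    (prevVisit_injective π R (Subtype.ext (π.injective (congrArg Prod.snd h))))
  have hcontract : (bernoulliPi (V × V) q).real {b | ¬ (cyclesIn (b ∘ g)).Nonempty} =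
      (bernoulliPi (R × R) q).real {η | ¬ (cyclesIn η).Nonempty} :=
    (measurePreserving_comp_bernoulliPi hg q).measureReal_preimage
      (s := {η | ¬ (cyclesIn η).Nonempty}) MeasurableSet.of_discrete.nullMeasurableSet
  have hhamilton : (bernoulliPi (R × R) q).real {η | ¬ (cyclesIn η).Nonempty} ≤ 2 / (#R : ℝ) := by
    simpa only [Fintype.card_coe] using bernoulliPi_real_not_nonempty_cyclesIn_le (V := R)
      (by rwa [Fintype.card_coe]) (by rwa [Fintype.card_coe])
  refine (measureReal_mono fun b hb ↦ mt ?_ hb).trans (hcontract.trans_le hhamilton)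
  rintro ⟨τ, hτ⟩
  rw [mem_cyclesIn] at hτ
  refine ⟨rejoin π τ, mem_cyclesIn.2 ⟨isCycleOn_rejoin hπ (card_pos.1 (by lia)) hτ.1, fun x ↦ ?_⟩,
    fun x ↦ rejoin_apply_of_notMem⟩
  by_cases hx : x ∈ R
  · rw [rejoin_apply_coe ⟨x, hx⟩]
    exact .inr (hτ.2 ⟨x, hx⟩)
  · rw [rejoin_apply_of_notMem hx]
    exact .inl (hA x hx)

theorem bernoulliPi_real_not_card_le_mul_card_cyclesIn_sup_le {V : Type*} [Fintype V]
    [LinearOrder V] {R : Finset V} (hR : 4 ≤ #R) {q : I} (hq : 88 * Real.log #R / #R ≤ q)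
    {C : Finset (Perm V)} (hC : ∀ π ∈ C, π.IsCycleOn Set.univ) {A : V × V → Prop}
    (hA : ∀ π ∈ C, ∀ x ∉ R, A (x, π x)) :
    (bernoulliPi (V × V) q).real {b | ¬ #C ≤ 2 * ((#R)! * #(cyclesIn (A ⊔ b)))} ≤ 4 / (#R : ℝ) := by
  classical
  set bad : Perm V → Set (V × V → Prop) :=
    fun π ↦ {b | ¬ ∃ ρ ∈ cyclesIn (A ⊔ b), ∀ x ∉ R, ρ x = π x}
  calc (bernoulliPi (V × V) q).real {b | ¬ #C ≤ 2 * ((#R)! * #(cyclesIn (A ⊔ b)))}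
      ≤ (bernoulliPi (V × V) q).real {b | #C < 2 * #{π ∈ C | b ∈ bad π}} := by
        refine measureReal_mono fun b hb ↦ ?_
        have hgood := card_filter_exists_mem_forall_notMem_eq_le C (cyclesIn (A ⊔ b)) R
        have hsplit := card_filter_add_card_filter_not (s := C) fun π ↦ b ∈ bad π
        simp only [bad, Set.mem_ofPred_eq, not_not] at hb hsplit ⊢
        lia
    _ ≤ 2 * (2 / (#R : ℝ)) :=
        real_lt_two_mul_card_filter_mem_le C (fun _ ↦ .of_discrete) (by positivity)
          fun π hπ ↦ bernoulliPi_real_not_exists_mem_cyclesIn_sup_le hR hq (hC π hπ) (hA π hπ)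
    _ = 4 / (#R : ℝ) := by ring

end Completion

section LowerBound

open scoped Classical in
theorem bernoulliPi_real_forall_le_hammingDist_curry_le {n r : ℕ} (hn : 2 ≤ n) {q : I}
    (hq : 0 < (q : ℝ)) :
    (bernoulliPi (Fin n × Fin n) q).real
      {A | ∀ A', (#(cyclicPerms (Fin n)) * (q : ℝ) ^ n / 2 ≤ #(cyclesIn A')) →
        r ≤ hammingDist (Function.curry A) (Function.curry A')} ≤
      4 * (n * Real.exp (q : ℝ)⁻¹) * Real.exp (-(r : ℝ) ^ 2 / n) := by
  have : (0 : ℝ) < n := mod_cast zero_lt_two.trans_le hn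
  set μ := Measure.pi fun _ : Fin n ↦ bernoulliPi (Fin n) q
  set S : Set (Fin n → Fin n → Prop) :=
    {ω | #(cyclicPerms (Fin n)) * (q : ℝ) ^ n / 2 ≤ #(cyclesIn (Function.uncurry ω))}
  set T : Set (Fin n → Fin n → Prop) := {ω | ∀ ω' ∈ S, r ≤ hammingDist ω ω'}
  have hcurry (s : Set (Fin n → Fin n → Prop)) :
      (bernoulliPi (Fin n × Fin n) q).real (Function.curry ⁻¹' s) = μ.real s :=
    (measurePreserving_curry_bernoulliPi q).measureReal_preimage
      MeasurableSet.of_discrete.nullMeasurableSet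
  have hS : (4 * (n * Real.exp (q : ℝ)⁻¹))⁻¹ ≤ μ.real S := by
    have hmany := inv_le_bernoulliPi_real_half_le_card_cyclesIn (V := Fin n) hq (by simpa using hn)
    rw [Fintype.card_fin] at hmany
    exact hmany.trans_eq (hcurry S)
  have hT : (4 * (n * Real.exp (q : ℝ)⁻¹))⁻¹ * μ.real T ≤ Real.exp (-(r : ℝ) ^ 2 / n) :=
    (mul_le_mul_of_nonneg_right hS measureReal_nonneg).trans
      (real_mul_real_le_hammingDist_le _ S r)
  refine (measureReal_mono (s₂ := Function.curry ⁻¹' T) fun A hA ω' hω' ↦ ?_).trans <|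
    (hcurry T).trans_le ((inv_mul_le_iff₀ (by positivity)).1 hT)
  exact hA (Function.uncurry ω') hω'

open scoped Classical in
theorem bernoulliPi_real_not_card_cyclesIn_le_of_hammingDist_lt {V : Type*} [Fintype V]
    [LinearOrder V] {r : ℕ} (hr : 4 ≤ r) (hrV : r ≤ Fintype.card V) {q : I}
    (hq : 88 * Real.log r / r ≤ q) {A A' : V × V → Prop}
    (hAA' : hammingDist (Function.curry A) (Function.curry A') < r) :
    (bernoulliPi (V × V) q).real {b | ¬ #(cyclesIn A') ≤ 2 * (r ! * #(cyclesIn (A ⊔ b)))} ≤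
      4 / (r : ℝ) := by
  obtain ⟨R, hdiff, rfl⟩ := exists_superset_card_eq hAA'.le hrV
  refine bernoulliPi_real_not_card_le_mul_card_cyclesIn_sup_le hr hq
    (fun π hπ ↦ (mem_cyclesIn.1 hπ).1) fun π hπ x hx ↦ ?_
  have hrow : Function.curry A x = Function.curry A' x := by
    by_contra hne
    exact hx (hdiff (mem_filter.2 ⟨mem_univ x, hne⟩))
  exact (congrFun hrow (π x)).mpr ((mem_cyclesIn.1 hπ).2 x)

theorem bernoulliPi_real_not_factorial_mul_pow_le_card_cyclesIn_le {n r : ℕ} (hr : 4 ≤ r)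
    (hrn : r ≤ n) {p p₁ p₂ : I} (hp₁ : 0 < (p₁ : ℝ)) (hp : σ p = σ p₁ * σ p₂)
    (hp₂ : 88 * Real.log r / r ≤ p₂) :
    (bernoulliPi (Fin n × Fin n) p).real
      {ω | ¬ n ! * (p₁ : ℝ) ^ n ≤ 4 * (n * (r ! * #(cyclesIn ω)))} ≤
      4 * (n * Real.exp (p₁ : ℝ)⁻¹) * Real.exp (-(r : ℝ) ^ 2 / n) + 4 / r := by
  classical
  have hfactorial : (n ! : ℝ) ≤ n * #(cyclicPerms (Fin n)) := by
    have := factorial_card_le_card_mul_card_cyclicPerms (V := Fin n) (by simp; lia)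
    rw [Fintype.card_fin] at this
    exact_mod_cast this
  rw [← (measurePreserving_sup_bernoulliPi hp).measureReal_preimage
    MeasurableSet.of_discrete.nullMeasurableSet]
  refine (prod_real_le_add .of_discrete .of_discrete (by positivity) fun A hA ↦ ?_).trans
    (add_le_add_left
      (bernoulliPi_real_forall_le_hammingDist_curry_le (r := r) (by lia) hp₁) _)
  simp only [Set.mem_ofPred_eq, not_forall, not_le] at hA
  obtain ⟨A', hmany, hclose⟩ := hA
  refine (measureReal_mono fun b ↦ mt fun hb ↦ ?_).trans
    (bernoulliPi_real_not_card_cyclesIn_le_of_hammingDist_lt hr (by simpa using hrn) hp₂ hclose)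
  have hb' : (#(cyclesIn A') : ℝ) ≤ 2 * (r ! * #(cyclesIn (A ⊔ b))) := mod_cast hb
  calc (n ! : ℝ) * (p₁ : ℝ) ^ n ≤ n * #(cyclicPerms (Fin n)) * (p₁ : ℝ) ^ n := by gcongr
    _ = 2 * n * (#(cyclicPerms (Fin n)) * (p₁ : ℝ) ^ n / 2) := by ring
    _ ≤ 2 * n * (2 * (r ! * #(cyclesIn (A ⊔ b)))) := by gcongr; exact hmany.trans hb'
    _ = 4 * (n * (r ! * #(cyclesIn (A ⊔ b)))) := by ring

end LowerBound

section HamiltonCycle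

open Equiv

variable {V : Type*}

theorem isCycleOn_univ_permCongr {W : Type*} (e : V ≃ W) {f : Perm V}
    (hf : f.IsCycleOn Set.univ) : (e.permCongr f).IsCycleOn Set.univ := by
  refine isCycleOn_univ_iff.2 fun x y ↦ ?_
  obtain ⟨i, hi⟩ := isCycleOn_univ_iff.1 hf (e.symm x) (e.symm y)
  refine ⟨i, ?_⟩
  rw [← e.permCongrHom_coe, ← map_zpow, e.permCongrHom_coe, permCongr_apply, hi, apply_symm_apply]

theorem isCycleOn_univ_permCongr_finRotate {k : ℕ} (hk : 2 ≤ k) (v : Fin k ≃ V) :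
    (v.permCongr (finRotate k)).IsCycleOn Set.univ :=
  isCycleOn_univ_permCongr v <| isCycleOn_univ_of_cycleType_eq <| by
    rw [cycleType_finRotate_of_le hk, Fintype.card_fin]

theorem exists_permCongr_finRotate_eq [Fintype V] (hV : 2 ≤ Fintype.card V) {π : Perm V}
    (hπ : π.IsCycleOn Set.univ) :
    ∃ v : Fin (Fintype.card V) ≃ V, v.permCongr (finRotate (Fintype.card V)) = π := by
  classical
  have := Fintype.one_lt_card_iff_nontrivial.1 hV
  have isCycle_and_support {τ : Perm V} (hτ : τ.IsCycleOn Set.univ) :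
      τ.IsCycle ∧ τ.support = univ :=
    ⟨Perm.isCycle_iff_exists_isCycleOn.2 ⟨_, Set.nontrivial_univ, hτ, fun _ _ ↦ Set.mem_univ _⟩,
      eq_univ_iff_forall.2 fun x ↦
        Perm.mem_support.2 (hτ.apply_ne Set.nontrivial_univ (Set.mem_univ x))⟩
  let e := (Fintype.equivFin V).symm
  obtain ⟨hcycle, hsupport⟩ := isCycle_and_support hπ
  obtain ⟨hcycle', hsupport'⟩ :=
    isCycle_and_support (isCycleOn_univ_permCongr_finRotate hV e)
  obtain ⟨c, hc⟩ := isConj_iff.1 (hcycle'.isConj hcycle (by rw [hsupport, hsupport']))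
  exact ⟨e.trans c, hc⟩

/-- The digraph with arcs `x → π x`. -/
def permDigraph (π : Perm V) : Digraph V where
  Adj x y := y = π x

theorem permDigraph_injective : Function.Injective (permDigraph (V := V)) := by
  intro π τ h
  ext x
  have hadj : (permDigraph π).Adj x (π x) := rfl
  rwa [h] at hadj

theorem isHamiltonCycle_iff_exists_permDigraph [Fintype V] (hV : 2 ≤ Fintype.card V)
    (H : Digraph V) :
    H.IsHamiltonCycle ↔ ∃ π : Perm V, π.IsCycleOn Set.univ ∧ permDigraph π = H := by
  have eq_iff {k : ℕ} (v : Fin k ≃ V) : permDigraph (v.permCongr (finRotate k)) = H ↔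
      ∀ x y, H.Adj x y ↔ ∃ i, x = v i ∧ y = v (finRotate k i) := by
    have hadj (x y : V) : y = v.permCongr (finRotate k) x ↔
        ∃ i, x = v i ∧ y = v (finRotate k i) := by
      simp [permCongr_apply, ← symm_apply_eq]
    simp only [Digraph.ext_iff, funext_iff, ← hadj, eq_iff_iff, permDigraph, Iff.comm]
  constructor
  · rintro ⟨k, v, hk, hv⟩
    exact ⟨_, isCycleOn_univ_permCongr_finRotate hk v, (eq_iff v).2 hv⟩
  · rintro ⟨π, hπ, hH⟩
    obtain ⟨v, rfl⟩ := exists_permCongr_finRotate_eq hV hπ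
    exact ⟨_, v, hV, (eq_iff v).1 hH⟩

theorem hamiltonCycleCount_ofArcSet [Fintype V] (hV : 2 ≤ Fintype.card V) (ω : V × V → Prop) :
    (Digraph.ofArcSet {e | e ∈ {e : V × V | e.1 ≠ e.2} ∧ ω e}).hamiltonCycleCount =
      #(cyclesIn ω) := by
  have := Fintype.one_lt_card_iff_nontrivial.1 hV
  rw [Digraph.hamiltonCycleCount, ← Set.ncard_coe_finset,
    ← Set.ncard_image_of_injective _ permDigraph_injective]
  congr 1
  ext H
  simp only [Set.mem_ofPred_eq, Set.mem_image, mem_coe, mem_cyclesIn,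
    isHamiltonCycle_iff_exists_permDigraph hV]
  constructor
  · rintro ⟨⟨π, hπ, rfl⟩, hle⟩
    exact ⟨π, ⟨hπ, fun x ↦ (hle (show (permDigraph π).Adj x (π x) from rfl)).2⟩, rfl⟩
  · rintro ⟨π, ⟨hπ, hω⟩, rfl⟩
    refine ⟨⟨π, hπ, rfl⟩, ?_⟩
    rintro x y rfl
    exact ⟨(hπ.apply_ne Set.nontrivial_univ (Set.mem_univ x)).symm, hω x⟩

theorem binomialRandom_real_hamiltonCycleCount_mem {n : ℕ} (hn : 2 ≤ n) (p : I) (s : Set ℕ) :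
    (Digraph.binomialRandom n p).real {D | D.hamiltonCycleCount ∈ s} =
      (bernoulliPi (Fin n × Fin n) p).real {ω | #(cyclesIn ω) ∈ s} := by
  rw [Digraph.binomialRandom, setBernoulli_eq_map_bernoulliPi,
    Measure.map_map .of_discrete .of_discrete, map_measureReal_apply .of_discrete .of_discrete]
  congr 1
  ext ω
  exact iff_of_eq (congrArg (· ∈ s) (hamiltonCycleCount_ofArcSet (by simpa using hn) ω))

end HamiltonCycle

section Asymptotic

theorem exists_tendsto_atTop_tendsto_diagonal {α : Type*} {l : Filter α} [l.IsCountablyGenerated]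
    {f : ℕ → ℕ → α} (hf : ∀ k, Tendsto (f k) atTop l) :
    ∃ κ : ℕ → ℕ, Tendsto κ atTop atTop ∧ Tendsto (fun n ↦ f (κ n) n) atTop l := by
  obtain ⟨s, hs⟩ := l.exists_antitone_basis
  have hmem (k : ℕ) : ∃ N, ∀ n ≥ N, f k n ∈ s k := eventually_atTop.1 (hf k (hs.mem k))
  choose N hN using hmem
  set κ : ℕ → ℕ := fun n ↦ Nat.findGreatest (fun k ↦ N k ≤ n) n
  have hκ : Tendsto κ atTop atTop := by
    refine tendsto_atTop.2 fun k ↦ ?_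
    filter_upwards [eventually_ge_atTop k, eventually_ge_atTop (N k)] with n hkn hNn
    exact Nat.le_findGreatest hkn hNn
  refine ⟨κ, hκ, hs.tendsto_right_iff.2 fun i _ ↦ ?_⟩
  filter_upwards [eventually_ge_atTop (N 0), hκ.eventually_ge_atTop i] with n hn hi
  exact hs.antitone hi <|
    hN _ _ (Nat.findGreatest_spec (P := fun k ↦ N k ≤ n) (Nat.zero_le n) hn)

theorem bernoulliPi_real_not_card_cyclesIn_le_le {V : Type*} [Fintype V] {q : I}
    (hq : 0 < (q : ℝ)) {c : ℝ} (hc : 0 < c) :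
    (bernoulliPi (V × V) q).real
      {ω | ¬ #(cyclesIn ω) ≤ c * (Fintype.card V)! * (q : ℝ) ^ Fintype.card V} ≤ c⁻¹ := by
  set N := Fintype.card V
  have hmarkov := mul_meas_ge_le_integral_of_nonneg (μ := bernoulliPi (V × V) q)
    (f := fun ω ↦ (#(cyclesIn ω) : ℝ)) (ae_of_all _ fun _ ↦ Nat.cast_nonneg _) .of_finite
    (c * N ! * (q : ℝ) ^ N)
  have hmean : ∫ ω, (#(cyclesIn ω) : ℝ) ∂bernoulliPi (V × V) q ≤ N ! * (q : ℝ) ^ N := by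
    rw [integral_card_cyclesIn]
    gcongr
    exact card_cyclicPerms_le
  have hthreshold : 0 < c * N ! * (q : ℝ) ^ N := by positivity
  refine (measureReal_mono fun ω hω ↦ (not_le.1 hω).le).trans
    (le_of_mul_le_mul_left ((hmarkov.trans hmean).trans_eq ?_) hthreshold)
  field_simp

theorem exists_symm_eq_symm_mul_symm_mul (γ q : I) :
    ∃ r : I, σ q = σ r * σ (γ * q) ∧ (1 - γ) * q ≤ (r : ℝ) := by
  obtain ⟨r, hr⟩ := exists_symm_eq_symm_mul_symm (unitInterval.mul_le_right (x := γ) (y := q))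
  refine ⟨r, hr.trans (mul_comm _ _), ?_⟩
  have hr' : (1 - q : ℝ) = (1 - γ * q) * (1 - r) := congrArg Subtype.val hr
  have : (0 : ℝ) ≤ γ * q * r := mul_nonneg (mul_nonneg γ.2.1 q.2.1) r.2.1
  linarith

/-- The number of vertices at which cycles are cut, a small multiple of `n / log n`. It is
negligible in the sense that its factorial is only exponential in `n`. -/
noncomputable def cutCount (η : ℝ) (n : ℕ) : ℕ := ⌊η * n / Real.log n⌋₊

theorem tendsto_log_pow_div_atTop (k : ℕ) :
    Tendsto (fun n : ℕ ↦ Real.log n ^ k / n) atTop (𝓝 0) :=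
  Real.isLittleO_pow_log_id_atTop.tendsto_div_nhds_zero.comp tendsto_natCast_atTop_atTop

theorem eventually_log_pow_div_le (k : ℕ) {c : ℝ} (hc : 0 < c) :
    ∀ᶠ n : ℕ in atTop, Real.log n ^ k / n ≤ c :=
  (tendsto_log_pow_div_atTop k).eventually_le_const hc

theorem tendsto_cutCount {η : ℝ} (hη : 0 < η) : Tendsto (cutCount η) atTop atTop := by
  have hlog : Tendsto (fun n : ℕ ↦ Real.log n ^ 1 / n) atTop (𝓝[>] 0) := by
    refine tendsto_nhdsWithin_iff.2 ⟨tendsto_log_pow_div_atTop 1, ?_⟩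
    filter_upwards [eventually_gt_atTop 1] with n hn
    have : 0 < Real.log n := Real.log_pos (mod_cast hn)
    simp only [Set.mem_Ioi]
    positivity
  refine tendsto_nat_floor_atTop.comp
    (((tendsto_inv_nhdsGT_zero.comp hlog).const_mul_atTop hη).congr fun n ↦ ?_)
  simp only [Function.comp_apply, pow_one, inv_div, mul_div_assoc]

theorem cutCount_mul_log_le {η : ℝ} (hη : 0 ≤ η) (n : ℕ) :
    cutCount η n * Real.log n ≤ η * n := by
  obtain hlog | hlog := (Real.log_natCast_nonneg n).eq_or_lt
  · rw [← hlog, mul_zero]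
    positivity
  · exact (le_div_iff₀ hlog).1 (Nat.floor_le (by positivity))

theorem one_le_log_natCast {n : ℕ} (hn : 3 ≤ n) : 1 ≤ Real.log n := by
  have hn3 : (3 : ℝ) ≤ n := mod_cast hn
  rw [Real.le_log_iff_exp_le (by positivity)]
  linarith [Real.exp_one_lt_three]

theorem cutCount_le {η : ℝ} (hη : η ≤ 1) {n : ℕ} (hn : 3 ≤ n) : cutCount η n ≤ n := by
  refine Nat.floor_le_of_le (div_le_of_le_mul₀ (by positivity) (by positivity) ?_)
  rw [mul_comm]
  gcongr
  exact hη.trans (one_le_log_natCast hn)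

theorem half_le_cutCount {η : ℝ} {n : ℕ} (h : 1 ≤ cutCount η n) :
    η * n / Real.log n / 2 ≤ cutCount η n := by
  have hfloor : η * n / Real.log n < cutCount η n + 1 := Nat.lt_floor_add_one _
  have hone : (1 : ℝ) ≤ cutCount η n := mod_cast h
  linarith

theorem eventually_four_mul_mul_factorial_cutCount_le {η : ℝ} (hη : 0 < η) (hη1 : η ≤ 1) :
    ∀ᶠ n : ℕ in atTop, 4 * n * ((cutCount η n)! : ℝ) ≤ Real.exp (2 * η * n) := by
  have hpoly : ∀ᶠ n : ℕ in atTop, 4 * n ≤ Real.exp (η * n) := by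
    filter_upwards [tendsto_natCast_atTop_atTop.eventually
      ((isLittleO_pow_exp_pos_mul_atTop 1 hη).bound (show (0 : ℝ) < 1 / 4 by norm_num))] with n hn
    simp only [pow_one, RCLike.norm_natCast, Real.norm_of_nonneg (Real.exp_nonneg _)] at hn
    linarith
  filter_upwards [hpoly, eventually_ge_atTop 3] with n hpoly hn
  have hfactorial : ((cutCount η n)! : ℝ) ≤ Real.exp (η * n) := by
    calc ((cutCount η n)! : ℝ) ≤ (n : ℝ) ^ cutCount η n := by
          exact_mod_cast (Nat.factorial_le_pow _).trans
            (Nat.pow_le_pow_left (cutCount_le hη1 hn) _)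
      _ = Real.exp (cutCount η n * Real.log n) := by
          rw [Real.exp_nat_mul, Real.exp_log (by positivity)]
      _ ≤ Real.exp (η * n) := Real.exp_le_exp.2 (cutCount_mul_log_le hη.le n)
  calc 4 * n * ((cutCount η n)! : ℝ) ≤ Real.exp (η * n) * Real.exp (η * n) := by gcongr
    _ = Real.exp (2 * η * n) := by rw [← Real.exp_add]; ring_nf

theorem one_sub_pow_mul_factorial_mul_pow_le {n r : ℕ} {ε q p₁ X : ℝ} (hε : 0 < ε) (hε1 : ε < 1)
    (hq : 0 ≤ q) (hp₁ : (1 - ε / 2) * q ≤ p₁) (hr : 4 * n * (r ! : ℝ) ≤ Real.exp (ε / 2 * n))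
    (hX0 : 0 ≤ X) (hX : n ! * p₁ ^ n ≤ 4 * (n * (r ! * X))) :
    (1 - ε) ^ n * n ! * q ^ n ≤ X := by
  have hbase : (1 - ε) * q ≤ (1 - ε / 2) * p₁ := by
    calc (1 - ε) * q ≤ (1 - ε / 2) * ((1 - ε / 2) * q) := by
          linarith [show 0 ≤ (ε / 2) ^ 2 * q by positivity]
      _ ≤ (1 - ε / 2) * p₁ := mul_le_mul_of_nonneg_left hp₁ (by linarith)
  have hpow : (1 - ε / 2) ^ n ≤ Real.exp (-(ε / 2 * n)) := by
    rw [← neg_mul, mul_comm, Real.exp_nat_mul]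
    exact pow_le_pow_left₀ (by linarith) (Real.one_sub_le_exp_neg _) n
  calc (1 - ε) ^ n * n ! * q ^ n = n ! * ((1 - ε) * q) ^ n := by
        rw [mul_pow]
        ring
    _ ≤ n ! * ((1 - ε / 2) * p₁) ^ n := by
        have : 0 ≤ (1 - ε) * q := mul_nonneg (by linarith) hq
        gcongr
    _ = (1 - ε / 2) ^ n * (n ! * p₁ ^ n) := by
        rw [mul_pow]
        ring
    _ ≤ Real.exp (-(ε / 2 * n)) * (4 * (n * (r ! * X))) :=
        (mul_le_mul_of_nonneg_left hX (pow_nonneg (by linarith) n)).trans (by gcongr)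
    _ = Real.exp (-(ε / 2 * n)) * (4 * n * r !) * X := by ring
    _ ≤ Real.exp (-(ε / 2 * n)) * Real.exp (ε / 2 * n) * X := by gcongr
    _ = X := by rw [← Real.exp_add, neg_add_cancel, Real.exp_zero, one_mul]

variable {p : ℕ → I}

theorem eventually_pos_of_log_sq_div_isLittleO
    (hp : (fun n : ℕ ↦ Real.log n ^ 2 / n) =o[atTop] fun n : ℕ ↦ (p n : ℝ)) :
    ∀ᶠ n in atTop, 0 < (p n : ℝ) := by
  filter_upwards [hp.isBigO.eq_zero_imp, eventually_gt_atTop 1] with n hzero hn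
  refine (p n).2.1.lt_of_ne' fun h ↦ ?_
  have : 0 < Real.log n := Real.log_pos (mod_cast hn)
  exact (show Real.log n ^ 2 / n ≠ 0 by positivity) (hzero h)

theorem eventually_log_cutCount_div_le
    (hp : (fun n : ℕ ↦ Real.log n ^ 2 / n) =o[atTop] fun n : ℕ ↦ (p n : ℝ)) {η γ : ℝ}
    (hη : 0 < η) (hη1 : η ≤ 1) (hγ : 0 < γ) :
    ∀ᶠ n : ℕ in atTop, 88 * Real.log (cutCount η n) / cutCount η n ≤ γ * p n := by
  filter_upwards [hp.bound (show 0 < γ * η / 176 by positivity), eventually_ge_atTop 3,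
    (tendsto_cutCount hη).eventually_ge_atTop 1] with n hsmall hn hr
  have hlog : 0 < Real.log n := zero_lt_one.trans_le (one_le_log_natCast hn)
  rw [Real.norm_of_nonneg (by positivity), Real.norm_of_nonneg (p n).2.1] at hsmall
  calc 88 * Real.log (cutCount η n) / cutCount η n
      ≤ 88 * Real.log n / (η * n / Real.log n / 2) := by
        gcongr
        · exact cutCount_le hη1 hn
        · exact half_le_cutCount hr
    _ = 176 / η * (Real.log n ^ 2 / n) := by
        field_simp
        norm_num
    _ ≤ 176 / η * (γ * η / 176 * p n) := by gcongr
    _ = γ * p n := by field_simp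

theorem eventually_inv_add_two_mul_log_le
    (hp : (fun n : ℕ ↦ Real.log n ^ 2 / n) =o[atTop] fun n : ℕ ↦ (p n : ℝ)) {η : ℝ}
    (hη : 0 < η) :
    ∀ᶠ n : ℕ in atTop, ∀ q : ℝ, p n / 2 ≤ q →
      q⁻¹ + 2 * Real.log n ≤ (cutCount η n : ℝ) ^ 2 / n := by
  filter_upwards [hp.bound (show 0 < η ^ 2 / 16 by positivity), eventually_ge_atTop 3,
    (tendsto_cutCount hη).eventually_ge_atTop 1,
    eventually_log_pow_div_le 3 (show 0 < η ^ 2 / 16 by positivity)] with n hsmall hn hr hcube q hq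
  have hlog : 0 < Real.log n := zero_lt_one.trans_le (one_le_log_natCast hn)
  rw [Real.norm_of_nonneg (by positivity), Real.norm_of_nonneg (p n).2.1] at hsmall
  set L := Real.log n
  have hinv : q⁻¹ ≤ η ^ 2 * n / (8 * L ^ 2) := by
    refine inv_le_of_inv_le₀ (by positivity) (le_trans ?_ hq)
    calc (η ^ 2 * n / (8 * L ^ 2))⁻¹ = 8 / η ^ 2 * (L ^ 2 / n) := by field_simp
      _ ≤ 8 / η ^ 2 * (η ^ 2 / 16 * p n) := by gcongr
      _ = p n / 2 := by
          field_simp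
          ring
  have hlog_le : 2 * L ≤ η ^ 2 * n / (8 * L ^ 2) := by
    rw [div_le_iff₀ (by positivity)] at hcube
    rw [le_div_iff₀ (by positivity)]
    linarith
  calc q⁻¹ + 2 * L ≤ η ^ 2 * n / (8 * L ^ 2) + η ^ 2 * n / (8 * L ^ 2) := add_le_add hinv hlog_le
    _ = (η * n / L / 2) ^ 2 / n := by
        field_simp
        norm_num
    _ ≤ (cutCount η n : ℝ) ^ 2 / n := by
        gcongr
        exact half_le_cutCount hr

theorem mul_exp_mul_exp_neg_sq_div_le {n r : ℕ} {x : ℝ}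
    (h : x + 2 * Real.log n ≤ (r : ℝ) ^ 2 / n) :
    4 * (n * Real.exp x) * Real.exp (-(r : ℝ) ^ 2 / n) ≤ 4 / n := by
  obtain rfl | hn := n.eq_zero_or_pos
  · simp
  have hexp : Real.exp (-(2 * Real.log n)) = ((n : ℝ) ^ 2)⁻¹ := by
    rw [Real.exp_neg, mul_comm, Real.exp_mul, Real.exp_log (mod_cast hn)]
    norm_cast
  calc 4 * (n * Real.exp x) * Real.exp (-(r : ℝ) ^ 2 / n)
      = 4 * n * Real.exp (x - (r : ℝ) ^ 2 / n) := by
        rw [neg_div, sub_eq_add_neg, Real.exp_add]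
        ring
    _ ≤ 4 * n * Real.exp (-(2 * Real.log n)) := by
        gcongr
        linarith
    _ = 4 / n := by
        rw [hexp]
        field_simp

theorem eventually_bernoulliPi_real_not_le_card_cyclesIn_le
    (hp : (fun n : ℕ ↦ Real.log n ^ 2 / n) =o[atTop] fun n : ℕ ↦ (p n : ℝ)) {ε : ℝ}
    (hε : 0 < ε) (hε1 : ε < 1) :
    ∀ᶠ n : ℕ in atTop, (bernoulliPi (Fin n × Fin n) (p n)).real
      {ω | ¬ (1 - ε) ^ n * n ! * (p n : ℝ) ^ n ≤ #(cyclesIn ω)} ≤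
        4 / n + 4 / cutCount (ε / 4) n := by
  have hη : 0 < ε / 4 := by positivity
  have hη1 : ε / 4 ≤ 1 := by linarith
  have hγ : 0 < ε / 2 := by positivity
  filter_upwards [eventually_pos_of_log_sq_div_isLittleO hp,
    eventually_log_cutCount_div_le hp hη hη1 hγ, eventually_inv_add_two_mul_log_le hp hη,
    eventually_four_mul_mul_factorial_cutCount_le hη hη1,
    (tendsto_cutCount hη).eventually_ge_atTop 4, eventually_ge_atTop 3]
    with n hpos hsprinkle htail hfactorial hr hn
  obtain ⟨p₁, hp₁, hle⟩ :=
    exists_symm_eq_symm_mul_symm_mul ⟨ε / 2, hγ.le, by linarith⟩ (p n)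
  have hle : (1 - ε / 2) * p n ≤ (p₁ : ℝ) := hle
  have hhalf : (p n : ℝ) / 2 ≤ p₁ := hle.trans' (by nlinarith)
  calc (bernoulliPi (Fin n × Fin n) (p n)).real
        {ω | ¬ (1 - ε) ^ n * n ! * (p n : ℝ) ^ n ≤ #(cyclesIn ω)}
      ≤ (bernoulliPi (Fin n × Fin n) (p n)).real
        {ω | ¬ n ! * (p₁ : ℝ) ^ n ≤ 4 * (n * ((cutCount (ε / 4) n)! * #(cyclesIn ω)))} :=
        measureReal_mono fun ω ↦ mt <| one_sub_pow_mul_factorial_mul_pow_le hε hε1 hpos.le hle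
          (hfactorial.trans_eq (by ring_nf)) (Nat.cast_nonneg _)
    _ ≤ 4 * (n * Real.exp (p₁ : ℝ)⁻¹) * Real.exp (-(cutCount (ε / 4) n : ℝ) ^ 2 / n) +
          4 / cutCount (ε / 4) n :=
        bernoulliPi_real_not_factorial_mul_pow_le_card_cyclesIn_le hr (cutCount_le hη1 hn)
          (hhalf.trans_lt' (half_pos hpos)) hp₁ hsprinkle
    _ ≤ 4 / n + 4 / cutCount (ε / 4) n := by
        gcongr
        exact mul_exp_mul_exp_neg_sq_div_le (htail p₁ hhalf)

theorem tendsto_bernoulliPi_real_not_le_card_cyclesIn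
    (hp : (fun n : ℕ ↦ Real.log n ^ 2 / n) =o[atTop] fun n : ℕ ↦ (p n : ℝ)) {ε : ℝ}
    (hε : 0 < ε) (hε1 : ε < 1) :
    Tendsto (fun n ↦ (bernoulliPi (Fin n × Fin n) (p n)).real
      {ω | ¬ (1 - ε) ^ n * n ! * (p n : ℝ) ^ n ≤ #(cyclesIn ω)}) atTop (𝓝 0) := by
  have hbound : Tendsto (fun n : ℕ ↦ 4 / (n : ℝ) + 4 / (cutCount (ε / 4) n : ℝ)) atTop (𝓝 0) := by
    have hdiv := tendsto_const_div_atTop_nhds_zero_nat (4 : ℝ)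
    simpa using hdiv.add (hdiv.comp (tendsto_cutCount (by positivity)))
  exact squeeze_zero' (.of_forall fun _ ↦ measureReal_nonneg)
    (eventually_bernoulliPi_real_not_le_card_cyclesIn_le hp hε hε1) hbound

theorem tendsto_bernoulliPi_real_not_card_cyclesIn_le (hp : ∀ᶠ n in atTop, 0 < (p n : ℝ)) {ε : ℝ}
    (hε : 0 < ε) :
    Tendsto (fun n ↦ (bernoulliPi (Fin n × Fin n) (p n)).real
      {ω | ¬ #(cyclesIn ω) ≤ (1 + ε) ^ n * n ! * (p n : ℝ) ^ n}) atTop (𝓝 0) := by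
  refine squeeze_zero' (.of_forall fun _ ↦ measureReal_nonneg) ?_
    (tendsto_pow_atTop_atTop_of_one_lt (show 1 < 1 + ε by linarith)).inv_tendsto_atTop
  filter_upwards [hp] with n hpos
  simpa only [Fintype.card_fin, Pi.inv_apply] using
    bernoulliPi_real_not_card_cyclesIn_le_le (V := Fin n) hpos
      (show 0 < (1 + ε) ^ n by positivity)

theorem tendsto_binomialRandom_real_hamiltonCycleCount_mem
    (hp : (fun n : ℕ ↦ Real.log n ^ 2 / n) =o[atTop] fun n : ℕ ↦ (p n : ℝ)) {ε : ℝ}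
    (hε : 0 < ε) (hε1 : ε < 1) :
    Tendsto (fun n ↦ (Digraph.binomialRandom n (p n)).real
      {D | (1 - ε) ^ n * n ! * (p n : ℝ) ^ n ≤ D.hamiltonCycleCount ∧
        D.hamiltonCycleCount ≤ (1 + ε) ^ n * n ! * (p n : ℝ) ^ n}) atTop (𝓝 1) := by
  have hfail := (tendsto_bernoulliPi_real_not_le_card_cyclesIn hp hε hε1).add
    (tendsto_bernoulliPi_real_not_card_cyclesIn_le (eventually_pos_of_log_sq_div_isLittleO hp) hε)
  have hsucceed := hfail.const_sub 1
  rw [add_zero, sub_zero] at hsucceed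
  refine tendsto_of_tendsto_of_tendsto_of_le_of_le' hsucceed tendsto_const_nhds ?_
    (.of_forall fun _ ↦ measureReal_le_one)
  filter_upwards [eventually_ge_atTop 2] with n hn
  have htransfer := binomialRandom_real_hamiltonCycleCount_mem hn (p n)
    {m | (1 - ε) ^ n * n ! * (p n : ℝ) ^ n ≤ m ∧ m ≤ (1 + ε) ^ n * n ! * (p n : ℝ) ^ n}
  simp only [Set.mem_ofPred_eq] at htransfer
  rw [htransfer, sub_le_comm, ← probReal_compl_eq_one_sub .of_discrete]
  exact (measureReal_mono (fun ω ↦ not_and_or.1) (measure_ne_top _ _)).trans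
    (measureReal_union_le _ _)

end Asymptotic

theorem theorem1p3 (p : ℕ → I)
    (hp : (fun n : ℕ => Real.log n ^ 2 / n) =o[atTop] (fun n : ℕ => (p n : ℝ))) :
    ∃ ε : ℕ → ℝ, (∀ n, 0 ≤ ε n ∧ ε n < 1) ∧ Tendsto ε atTop (𝓝 0) ∧
      Tendsto
        (fun n : ℕ => (Digraph.binomialRandom n (p n)).real
          {D : Digraph (Fin n) |
            (1 - ε n) ^ n * (n.factorial : ℝ) * (p n : ℝ) ^ n ≤ (D.hamiltonCycleCount : ℝ) ∧
            (D.hamiltonCycleCount : ℝ) ≤ (1 + ε n) ^ n * (n.factorial : ℝ) * (p n : ℝ) ^ n})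
        atTop (𝓝 1) := by
  obtain ⟨ε, -, hε, hε0⟩ := exists_seq_strictAnti_tendsto' (zero_lt_one (α := ℝ))
  obtain ⟨κ, hκ, hdiagonal⟩ := exists_tendsto_atTop_tendsto_diagonal fun k ↦
    tendsto_binomialRandom_real_hamiltonCycleCount_mem hp (hε k).1 (hε k).2
  exact ⟨ε ∘ κ, fun n ↦ ⟨(hε (κ n)).1.le, (hε (κ n)).2⟩, hε0.comp hκ, hdiagonal⟩
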